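/- Write $|\cdot|_\infty$ for the maximum norm and $|\cdot|$ for the Euclidean norm on $\mathbb R^2$, $Q_s(o)=[-s/2,s/2]^2$, and let $e_1,e_2$ be the standard unit vectors. A finite or infinite sequence $\xi_0,\xi_1,\dots$ of points of a locally finite set in $\mathbb R^2$ is a $b$-bounded anisotropic descending chain if $|\xi_0-\xi_1|_\infty\le b$ and $|\xi_{i}-\xi_{i+1}|_\infty<|\xi_{i-1}-\xi_{i}|_\infty$ for all $i\ge1$ (for which the points occur in the sequence); an anisotropic descending chain is one that is $b$-bounded for some $b>0$. Let $\mathbb N'$ be the class of all non-empty locally finite sets $\varphi\subset\mathbb R^2\times\{\pm e_1,\pm e_2\}$, each location carrying a single mark, such that (i) the set of locations of $\varphi$ contains no infinite anisotropic descending chain; (ii) $(\xi-\eta)/|\xi-\eta|\notin\{\pm e_1,\pm e_2,(\pm e_1\pm e_2)/\sqrt2\}$ for all distinct $(\xi,v),(\eta,w)\in\varphi$; (iii) there is exactly one function $f:\varphi\to[0,\infty]$ such that - $[\xi,\xi+f(x)v)\cap[\eta,\eta+f(y)w)=\emptyset$ for all distinct $x=(\xi,v),y=(\eta,w)\in\varphi$,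 and - for every $x=(\xi,v)\in\varphi$ with $f(x)<\infty$ there is a unique $y=(\eta,w)\in\varphi$ with $\xi+f(x)v\in[\eta,\eta+f(y)w)$ and $|\xi+f(x)v-\eta|<f(x)$, and this function satisfies $f(x)<\infty$ for all $x\in\varphi$. Let $\lambda>0$. Then: (a) Let $X\subset\mathbb R^2$ be a homogeneous Poisson point process with intensity $\lambda$, let $n\ge1$ be an integer and $b,s>0$. The probability that there are pairwise distinct $X_0,\dots,X_n\in X$ with $X_0\in Q_s(o)$ such that $X_0,\dots,X_n$ is a $b$-bounded anisotropic descending chain is at most $$\frac{s^2(4b^2)^n\lambda^{n+1}}{n!}.$$ (b) Let $X\subset\mathbb R^2\times\{\pm e_1,\pm e_2\}$ be a homogeneous Poisson point process with intensity $\lambda$ whose points carry independent marks, uniformly distributed on $\{\pm e_1,\pm e_2\}$ and independent of the locations. Then almost surely the set of locations of $X$ contains no infinite anisotropic descending chain, and $X\in\mathbb N'$. -/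

import Mathlib

open MeasureTheory ProbabilityTheory
open scoped NNReal ENNReal

namespace Lilypond

/-- The plane, with its Euclidean norm `‖·‖` and Lebesgue measure `volume`. -/
abbrev Plane : Type := EuclideanSpace ℝ (Fin 2)

/-- The sup-norm `|ξ|_∞` (the norm of `Fin 2 → ℝ` in Mathlib is the sup-norm). -/
noncomputable def supNorm (ξ : Plane) : ℝ := ‖WithLp.ofLp ξ‖

/-- The closed square `Q_s(o) = [-s/2, s/2]²`. -/
def square (s : ℝ) : Set Plane := {ξ | ∀ i, ξ i ∈ Set.Icc (-s / 2) (s / 2)}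

/-- A set of points of the plane is locally finite if each bounded set contains only finitely
many of its points. -/
def LocallyFiniteSet (φ : Set Plane) : Prop :=
  ∀ B : Set Plane, Bornology.IsBounded B → (φ ∩ B).Finite

/-- `X` is a homogeneous Poisson point process with intensity `lam` under `P`: a random locally
finite set with measurable counts such that the number of points in a bounded Borel set `B` is
Poisson distributed with mean `lam * |B|`, and the numbers of points in disjoint sets are
independent. -/
structure IsPoissonProcess {Ω : Type*} [MeasurableSpace Ω] (P : Measure Ω) (lam : ℝ≥0)
    (X : Ω → Set Plane) : Prop where
  locallyFinite : ∀ ω, LocallyFiniteSet (X ω)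
  measurable_count : ∀ B : Set Plane, MeasurableSet B → Bornology.IsBounded B →
    Measurable (fun ω => (X ω ∩ B).ncard)
  law_count : ∀ B : Set Plane, MeasurableSet B → Bornology.IsBounded B →
    P.map (fun ω => (X ω ∩ B).ncard) = poissonMeasure (lam * (volume B).toNNReal)
  indep_count : ∀ (k : ℕ) (B : Fin k → Set Plane), (∀ i, MeasurableSet (B i)) →
    (∀ i, Bornology.IsBounded (B i)) → Pairwise (fun i j => Disjoint (B i) (B j)) →
    iIndepFun (fun i ω => (X ω ∩ B i).ncard) P

/-- The first `N` points (`N = ⊤`: all points) of the sequence `x` lie in `φ` and form a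
`b`-bounded anisotropic descending chain. -/
def IsBoundedDescendingChain (φ : Set Plane) (b : ℝ) (N : ℕ∞) (x : ℕ → Plane) : Prop :=
  (∀ i : ℕ, (i : ℕ∞) < N → x i ∈ φ) ∧
  ((1 : ℕ∞) < N → supNorm (x 0 - x 1) ≤ b) ∧
  ∀ i : ℕ, ((i + 2 : ℕ) : ℕ∞) < N → supNorm (x (i + 1) - x (i + 2)) < supNorm (x i - x (i + 1))

/-- `φ` contains an infinite anisotropic descending chain. -/
def HasInfiniteDescendingChain (φ : Set Plane) : Prop :=
  ∃ b : ℝ, 0 < b ∧ ∃ x : ℕ → Plane, IsBoundedDescendingChain φ b ⊤ x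

/-- The event that there are `n + 1` pairwise distinct points of `X`, the first of them in
`Q_s(o)`, which form a `b`-bounded anisotropic descending chain. -/
def chainEvent {Ω : Type*} (X : Ω → Set Plane) (s b : ℝ) (n : ℕ) : Set Ω :=
  {ω | ∃ x : ℕ → Plane, Set.InjOn x {i | i ≤ n} ∧ x 0 ∈ square s ∧
    IsBoundedDescendingChain (X ω) b ((n + 1 : ℕ) : ℕ∞) x}

/-- The first (`i = 0`) and second (`i = 1`) standard unit vector. -/
noncomputable def unitVec (i : Fin 2) : Plane := EuclideanSpace.single i 1

/-- The mark space `{±e₁, ±e₂}`: a coordinate axis and a sign (`true` for `+`). -/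
abbrev Mark : Type := Fin 2 × Bool

/-- The direction of growth encoded by a mark. -/
noncomputable def Mark.dir (v : Mark) : Plane := if v.2 then unitVec v.1 else -unitVec v.1

/-- Marked locally finite sets: locally finite, each location carrying a single mark. -/
def IsMarkedLocallyFinite (φ : Set (Plane × Mark)) : Prop :=
  (∀ B : Set Plane, Bornology.IsBounded B → (φ ∩ B ×ˢ Set.univ).Finite) ∧ Set.InjOn Prod.fst φ

/-- `X` is an independently and uniformly marked homogeneous Poisson point process: its points
form a homogeneous Poisson point process, and (almost surely) `X = {(ξ i, m i) : i < κ}` for a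
measurable enumeration `ξ` of its `κ ≤ ∞` distinct points and marks `m i` which are independent,
uniform on the four directions, and independent of `(κ, ξ)`. -/
structure IsUniformlyMarkedPoissonProcess {Ω : Type*} [MeasurableSpace Ω] (P : Measure Ω)
    (lam : ℝ≥0) (X : Ω → Set (Plane × Mark)) : Prop where
  poisson : IsPoissonProcess P lam (fun ω => Prod.fst '' X ω)
  marking : ∃ (κ : Ω → ℕ∞) (ξ : ℕ → Ω → Plane) (m : ℕ → Ω → Mark),
    Measurable κ ∧ (∀ i, Measurable (ξ i)) ∧ (∀ i, Measurable (m i)) ∧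
    (∀ᵐ ω ∂P, Set.InjOn (fun i => ξ i ω) {i | (i : ℕ∞) < κ ω} ∧
      X ω = {p | ∃ i : ℕ, (i : ℕ∞) < κ ω ∧ p = (ξ i ω, m i ω)}) ∧
    (∀ (i : ℕ) (v : Mark), P {ω | m i ω = v} = 1 / 4) ∧
    iIndepFun m P ∧
    IndepFun (fun ω => (κ ω, fun i => ξ i ω)) (fun ω i => m i ω) P

/-- The half-open segment `[ξ, ξ + r v)` for `x = (ξ, v)`; a half-line for `r = ∞`. -/
def growthSegment (x : Plane × Mark) (r : ℝ≥0∞) : Set Plane :=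
  {p | ∃ t : ℝ, 0 ≤ t ∧ ENNReal.ofReal t < r ∧ p = x.1 + t • x.2.dir}

/-- `f` is a length function of the anisotropic lilypond model on `φ`: it has the hard-core
property, and every segment of finite length has a unique stopping neighbor. -/
structure IsLilypondLength (φ : Set (Plane × Mark)) (f : φ → ℝ≥0∞) : Prop where
  hardCore : ∀ x y : φ, x ≠ y → Disjoint (growthSegment x (f x)) (growthSegment y (f y))
  stopping : ∀ x : φ, f x ≠ ⊤ → ∃! y : φ,
    x.1.1 + (f x).toReal • x.1.2.dir ∈ growthSegment y (f y) ∧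
    ‖x.1.1 + (f x).toReal • x.1.2.dir - y.1.1‖ < (f x).toReal

/-- The directions `±e₁, ±e₂, (±e₁ ± e₂)/√2`. -/
noncomputable def forbiddenDirections : Set Plane :=
  let e₁ := unitVec 0
  let e₂ := unitVec 1
  {e₁, -e₁, e₂, -e₂, (√2 : ℝ)⁻¹ • (e₁ + e₂), (√2 : ℝ)⁻¹ • (e₁ - e₂),
    (√2 : ℝ)⁻¹ • (-e₁ + e₂), (√2 : ℝ)⁻¹ • (-e₁ - e₂)}

/-- The admissible class `N'`. -/
structure IsAdmissible (φ : Set (Plane × Mark)) : Prop where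
  nonempty : φ.Nonempty
  locallyFinite : IsMarkedLocallyFinite φ
  noChain : ¬ HasInfiniteDescendingChain (Prod.fst '' φ)
  generic : ∀ x ∈ φ, ∀ y ∈ φ, x ≠ y → ‖x.1 - y.1‖⁻¹ • (x.1 - y.1) ∉ forbiddenDirections
  finiteLength : ∃ f : φ → ℝ≥0∞, IsLilypondLength φ f ∧
    (∀ g : φ → ℝ≥0∞, IsLilypondLength φ g → g = f) ∧ ∀ x, f x < ⊤

end Lilypond

namespace Lilypond

/-! ### Elementary geometry of the marked plane -/

/-! The chain estimate is a first moment bound on a grid of side `ε`. For small `ε` a chain visits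
distinct cells, and its integer steps shrink up to a rounding error of one. About `(s/ε)²
(2b/ε)^(2n) / n!` discrete chains have this property (`card_chainFinset_le`). By independence, all
cells of a given one are occupied with probability at most `(λ ε²)^(n+1)`. The powers of `ε` cancel,
and `ε → 0` gives the bound (`measure_chainEvent_le`). Since it tends to zero in `n`, infinite
chains are null; loop erasure reduces to chains of distinct points. The same grid method excludes
forbidden directions: about `ε⁻³` cell pairs compete with a probability of order `ε⁴`.

Existence and uniqueness of the length function are deterministic. Whether `x` has stopped by time
`t` depends on whether some `y` reaches the common crossing first and is still growing there.
Passing from `x` to `y` shortens the relevant distance, so an infinite regress would be a descending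
chain. Thus the recursion is well founded and has one solution (`exists_unique_length`).

For finiteness of the lengths, infinitely many disjoint windows lie ahead of each unit cell, in each
direction. By Borel–Cantelli infinitely many of them contain a single isolated point in the right
place, and one of these points has the mark that makes it grow across the path (`ae_exists_block`).
Being isolated, it cannot be stopped in time and therefore blocks every point of the cell with that
direction. -/

theorem supNorm_eq_max (ξ : Plane) : supNorm ξ = max |ξ 0| |ξ 1| := by
  apply le_antisymm
  · refine (pi_norm_le_iff_of_nonneg (le_max_of_le_left (abs_nonneg _))).2 fun i => ?_
    fin_cases i
    · exact le_max_left _ _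
    · exact le_max_right _ _
  · exact max_le (norm_le_pi_norm (WithLp.ofLp ξ) 0) (norm_le_pi_norm (WithLp.ofLp ξ) 1)

theorem supNorm_sub_comm (ξ η : Plane) : supNorm (ξ - η) = supNorm (η - ξ) := by
  simp only [supNorm_eq_max, PiLp.sub_apply, abs_sub_comm]

theorem abs_apply_le_supNorm (ξ : Plane) (l : Fin 2) : |ξ l| ≤ supNorm ξ :=
  norm_le_pi_norm (WithLp.ofLp ξ) l

theorem norm_le_two_mul_supNorm (ξ : Plane) : ‖ξ‖ ≤ 2 * supNorm ξ := by
  rw [EuclideanSpace.norm_eq, Fin.sum_univ_two, Real.norm_eq_abs, Real.norm_eq_abs]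
  have h0 := abs_apply_le_supNorm ξ 0
  have h1 := abs_apply_le_supNorm ξ 1
  have h0' := abs_nonneg (ξ 0)
  have h1' := abs_nonneg (ξ 1)
  rw [Real.sqrt_le_left (by linarith)]
  nlinarith

theorem norm_eq_sqrt (ξ : Plane) : ‖ξ‖ = √(ξ 0 ^ 2 + ξ 1 ^ 2) := by
  rw [EuclideanSpace.norm_eq, Fin.sum_univ_two, Real.norm_eq_abs, Real.norm_eq_abs, sq_abs, sq_abs]

/-- The sign of a mark. -/
noncomputable def sgn (b : Bool) : ℝ := if b then 1 else -1

theorem sgn_mul_self (b : Bool) : sgn b * sgn b = 1 := by cases b <;> simp [sgn]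

theorem abs_sgn (b : Bool) : |sgn b| = 1 := by cases b <;> simp [sgn]

theorem dir_self (v : Mark) : v.dir v.1 = sgn v.2 := by
  rcases v with ⟨i, b⟩
  cases b <;> simp [Mark.dir, unitVec, sgn]

theorem dir_of_ne (v : Mark) {l : Fin 2} (h : l ≠ v.1) : v.dir l = 0 := by
  rcases v with ⟨i, b⟩
  cases b <;> simp [Mark.dir, unitVec, h]

theorem norm_dir (v : Mark) : ‖v.dir‖ = 1 := by
  rcases v with ⟨i, b⟩
  cases b <;> simp [Mark.dir, unitVec]

theorem plane_ext_of_ne {i j : Fin 2} (h : i ≠ j) {ξ η : Plane} (hi : ξ i = η i) (hj : ξ j = η j) :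
    ξ = η := by
  ext l
  have : l = i ∨ l = j := by omega
  rcases this with rfl | rfl <;> assumption

theorem supNorm_eq_max_of_ne {i j : Fin 2} (h : i ≠ j) (ξ : Plane) :
    supNorm ξ = max |ξ i| |ξ j| := by
  rw [supNorm_eq_max]
  have : (i = 0 ∧ j = 1) ∨ (i = 1 ∧ j = 0) := by omega
  rcases this with ⟨rfl, rfl⟩ | ⟨rfl, rfl⟩
  · rfl
  · exact max_comm _ _

/-- Replaces the eight normalized directions by coordinate relations, each of which is a union of
linear equations and can be tested on grid cells. -/
theorem direction_mem_forbidden_iff {d : Plane} (hd : d ≠ 0) :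
    ‖d‖⁻¹ • d ∈ forbiddenDirections ↔ d 0 = 0 ∨ d 1 = 0 ∨ |d 0| = |d 1| := by
  have hn : ‖d‖⁻¹ ≠ 0 := inv_ne_zero (norm_ne_zero_iff.2 hd)
  have hext : ∀ v : Plane, ‖d‖⁻¹ • d = v ↔ ‖d‖⁻¹ * d 0 = v 0 ∧ ‖d‖⁻¹ * d 1 = v 1 := by
    intro v
    constructor
    · rintro rfl
      exact ⟨rfl, rfl⟩
    · rintro ⟨h0, h1⟩
      exact plane_ext_of_ne (i := 0) (j := 1) (by decide) h0 h1
  simp only [forbiddenDirections, Set.mem_insert_iff, Set.mem_singleton_iff, hext]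
  simp only [unitVec, PiLp.neg_apply, PiLp.add_apply, PiLp.sub_apply, PiLp.smul_apply,
    PiLp.single_apply, smul_eq_mul, if_true, Fin.isValue, zero_ne_one, one_ne_zero,
    if_false, neg_zero, sub_zero, zero_sub, add_zero, zero_add, mul_one, mul_neg]
  constructor
  · rintro (h | h | h | h | h | h | h | h)
    · exact Or.inr (Or.inl ((mul_eq_zero.1 h.2).resolve_left hn))
    · exact Or.inr (Or.inl ((mul_eq_zero.1 h.2).resolve_left hn))
    · exact Or.inl ((mul_eq_zero.1 h.1).resolve_left hn)
    · exact Or.inl ((mul_eq_zero.1 h.1).resolve_left hn)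
    · exact Or.inr (Or.inr (abs_eq_abs.2 (Or.inl (mul_left_cancel₀ hn (by linarith [h.1, h.2])))))
    · exact Or.inr (Or.inr (abs_eq_abs.2 (Or.inr (mul_left_cancel₀ hn (by linarith [h.1, h.2])))))
    · exact Or.inr (Or.inr (abs_eq_abs.2 (Or.inr (mul_left_cancel₀ hn (by linarith [h.1, h.2])))))
    · exact Or.inr (Or.inr (abs_eq_abs.2 (Or.inl (mul_left_cancel₀ hn (by linarith [h.1, h.2])))))
  · have hne : d 0 ≠ 0 ∨ d 1 ≠ 0 := by
      by_contra! h
      exact hd (plane_ext_of_ne (i := 0) (j := 1) (by decide) h.1 h.2)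
    have hsq : 0 ≤ d 0 ^ 2 + d 1 ^ 2 := by positivity
    rintro (h | h | h)
    · have h1 : d 1 ≠ 0 := hne.resolve_left fun h' => h' h
      have hnorm : ‖d‖ = |d 1| := by rw [norm_eq_sqrt, h, ← Real.sqrt_sq_eq_abs]; congr 1; ring
      rw [hnorm, h]
      rcases abs_cases (d 1) with ⟨e, _⟩ | ⟨e, _⟩ <;> rw [e] <;>
        simp [h1, inv_neg]
    · have h0 : d 0 ≠ 0 := hne.resolve_right fun h' => h' h
      have hnorm : ‖d‖ = |d 0| := by rw [norm_eq_sqrt, h, ← Real.sqrt_sq_eq_abs]; congr 1; ring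
      rw [hnorm, h]
      rcases abs_cases (d 0) with ⟨e, _⟩ | ⟨e, _⟩ <;> rw [e] <;>
        simp [h0, inv_neg]
    · have h01 : d 0 ^ 2 = d 1 ^ 2 := sq_eq_sq_iff_abs_eq_abs _ _ |>.2 h
      have h1 : d 1 ≠ 0 := by
        rcases hne with h' | h'
        · intro h1
          rw [h1] at h
          simp at h
          exact h' h
        · exact h'
      have hnorm : ‖d‖ = √2 * |d 1| := by
        rw [norm_eq_sqrt, h01, ← Real.sqrt_sq_eq_abs, ← Real.sqrt_mul (by norm_num)]
        congr 1; ring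
      rw [hnorm]
      rcases abs_eq_abs.1 h with e' | e' <;> rw [e'] <;>
      rcases abs_cases (d 1) with ⟨e, _⟩ | ⟨e, _⟩ <;> rw [e] <;>
        field_simp <;> simp

/-- The time at which the segment growing from `x` reaches the line through the location of `y`
that is perpendicular to the direction of growth of `x`. -/
noncomputable def along (x y : Plane × Mark) : ℝ := sgn x.2.2 * (y.1 x.2.1 - x.1 x.2.1)

/-- `y` is able to stop `x`: the half-lines of `x` and `y` cross, and `y` is the first to reach
the crossing. -/
def CanStop (x y : Plane × Mark) : Prop :=
  x.2.1 ≠ y.2.1 ∧ 0 ≤ along y x ∧ along y x < along x y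

theorem abs_along (x y : Plane × Mark) : |along x y| = |y.1 x.2.1 - x.1 x.2.1| := by
  rw [along, abs_mul, abs_sgn, one_mul]

theorem abs_along' (x y : Plane × Mark) : |along x y| = |x.1 x.2.1 - y.1 x.2.1| := by
  rw [abs_along, abs_sub_comm]

/-- The two growth times to the crossing are the coordinate distances, and the stopped point has the
longer one. This is the link between the growth model and chains in the maximum norm. -/
theorem CanStop.supNorm_eq {x y : Plane × Mark} (h : CanStop x y) :
    supNorm (x.1 - y.1) = along x y := by
  rw [supNorm_eq_max_of_ne h.1, PiLp.sub_apply, PiLp.sub_apply, ← abs_along', ← abs_along,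
    abs_of_nonneg h.2.1, abs_of_nonneg (h.2.1.trans h.2.2.le), max_eq_left h.2.2.le]

/-- The times are signed, so this is an identity for the two perpendicular lines, wherever they
cross. -/
theorem crossing_eq {x y : Plane × Mark} (h : x.2.1 ≠ y.2.1) :
    x.1 + along x y • x.2.dir = y.1 + along y x • y.2.dir := by
  apply plane_ext_of_ne h
  · simp only [PiLp.add_apply, PiLp.smul_apply, smul_eq_mul, dir_self, dir_of_ne _ h, along]
    linear_combination (y.1 x.2.1 - x.1 x.2.1) * sgn_mul_self x.2.2
  · simp only [PiLp.add_apply, PiLp.smul_apply, smul_eq_mul, dir_self, dir_of_ne _ h.symm, along]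
    linear_combination -(x.1 y.2.1 - y.1 y.2.1) * sgn_mul_self y.2.2

theorem eq_along_of_crossing {x y : Plane × Mark} (h : x.2.1 ≠ y.2.1) {t t' : ℝ}
    (he : x.1 + t • x.2.dir = y.1 + t' • y.2.dir) : t = along x y := by
  have := congrArg (fun p : Plane => p x.2.1) he
  simp only [PiLp.add_apply, PiLp.smul_apply, smul_eq_mul, dir_self, dir_of_ne _ h] at this
  rw [along]
  linear_combination (sgn x.2.2) * this - t * sgn_mul_self x.2.2

theorem mem_growthSegment_crossing {x y : Plane × Mark} (h : x.2.1 ≠ y.2.1) {r : ℝ≥0∞}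
    (h0 : 0 ≤ along y x) (hr : ENNReal.ofReal (along y x) < r) :
    x.1 + along x y • x.2.dir ∈ growthSegment y r :=
  ⟨along y x, h0, hr, crossing_eq h⟩

/-- Two locations are in general position: their difference has none of the forbidden
directions. -/
def GeneralPosition (ξ η : Plane) : Prop :=
  (∀ l, ξ l ≠ η l) ∧ |ξ 0 - η 0| ≠ |ξ 1 - η 1|

theorem generalPosition_iff {ξ η : Plane} (h : ξ ≠ η) :
    GeneralPosition ξ η ↔ ‖ξ - η‖⁻¹ • (ξ - η) ∉ forbiddenDirections := by
  rw [direction_mem_forbidden_iff (sub_ne_zero.2 h), GeneralPosition, Fin.forall_fin_two]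
  simp only [PiLp.sub_apply, sub_eq_zero]
  tauto

theorem GeneralPosition.ne_of_ne {ξ η : Plane} (h : GeneralPosition ξ η) {i j : Fin 2}
    (hij : i ≠ j) : |ξ i - η i| ≠ |ξ j - η j| := by
  have : (i = 0 ∧ j = 1) ∨ (i = 1 ∧ j = 0) := by omega
  rcases this with ⟨rfl, rfl⟩ | ⟨rfl, rfl⟩
  · exact h.2
  · exact h.2.symm

/-- If the segments of two marked points in general position meet, one of them can stop the
other one before its end. -/
theorem canStop_of_not_disjoint {x y : Plane × Mark} (hg : GeneralPosition x.1 y.1)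
    {r r' : ℝ≥0∞} (h : ¬ Disjoint (growthSegment x r) (growthSegment y r')) :
    (CanStop x y ∧ ENNReal.ofReal (along x y) < r ∧ ENNReal.ofReal (along y x) < r') ∨
    (CanStop y x ∧ ENNReal.ofReal (along x y) < r ∧ ENNReal.ofReal (along y x) < r') := by
  obtain ⟨p, ⟨t, ht0, ht, hp⟩, t', ht0', ht', hp'⟩ := Set.not_disjoint_iff.1 h
  rw [hp] at hp'
  by_cases hxy : x.2.1 = y.2.1
  · exfalso
    obtain ⟨l, hl⟩ : ∃ l : Fin 2, l ≠ x.2.1 := exists_ne _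
    have := congrArg (fun p : Plane => p l) hp'
    simp only [PiLp.add_apply, PiLp.smul_apply, smul_eq_mul, dir_of_ne _ hl,
      dir_of_ne y.2 (hxy ▸ hl), mul_zero, add_zero] at this
    exact hg.1 l this
  · obtain rfl := eq_along_of_crossing hxy hp'
    obtain rfl := eq_along_of_crossing (Ne.symm hxy) hp'.symm
    have hne : along x y ≠ along y x := by
      intro he
      apply hg.ne_of_ne hxy
      rw [← abs_along', ← abs_along, he]
    rcases lt_or_gt_of_ne hne with hlt | hlt
    · exact Or.inr ⟨⟨Ne.symm hxy, ht0, hlt⟩, ht, ht'⟩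
    · exact Or.inl ⟨⟨hxy, ht0', hlt⟩, ht, ht'⟩

theorem CanStop.not_disjoint {x y : Plane × Mark} (h : CanStop x y) {r r' : ℝ≥0∞}
    (hr : ENNReal.ofReal (along x y) < r) (hr' : ENNReal.ofReal (along y x) < r') :
    ¬ Disjoint (growthSegment x r) (growthSegment y r') :=
  Set.not_disjoint_iff.2 ⟨_, ⟨along x y, h.2.1.trans h.2.2.le, hr, rfl⟩,
    mem_growthSegment_crossing h.1 h.2.1 hr'⟩

/-! ### Existence and uniqueness of the length function -/

section Length

variable {φ : Set (Plane × Mark)}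

/-- A stopping query `(y, c)` has to be answered before the query `(x, t)`. -/
def QueryRel (φ : Set (Plane × Mark)) (q p : φ × ℝ) : Prop :=
  CanStop p.1.1 q.1.1 ∧ along p.1.1 q.1.1 ≤ p.2 ∧ q.2 = along q.1.1 p.1.1

/-- Along an infinite regress, each distance to the next point is at most the current time bound.
That bound is the shorter leg of the previous crossing, hence smaller than the previous distance,
and the locations form a descending chain. -/
theorem queryRel_wellFounded (h : ¬ HasInfiniteDescendingChain (Prod.fst '' φ)) :
    WellFounded (QueryRel φ) := by
  rw [wellFounded_iff_isEmpty_descending_chain]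
  refine ⟨fun ⟨p, hp⟩ => h ?_⟩
  have hsup : ∀ i, supNorm ((p i).1.1.1 - (p (i + 1)).1.1.1) =
      along (p i).1.1 (p (i + 1)).1.1 := fun i => (hp i).1.supNorm_eq
  refine ⟨along (p 0).1.1 (p 1).1.1, (hp 0).1.2.1.trans_lt (hp 0).1.2.2,
    fun i => (p i).1.1.1, fun i _ => ⟨_, (p i).1.2, rfl⟩, fun _ => (hsup 0).le, fun i _ => ?_⟩
  simp only
  rw [hsup i, hsup (i + 1)]
  calc along (p (i + 1)).1.1 (p (i + 1 + 1)).1.1 ≤ (p (i + 1)).2 := (hp (i + 1)).2.1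
    _ = along (p (i + 1)).1.1 (p i).1.1 := (hp i).2.2
    _ < _ := (hp i).1.2.2

/-- `S (x, t)` reads "`x` has stopped by time `t`": some `y` able to stop `x` by then has not
stopped before reaching, or on reaching, the crossing. -/
theorem exists_stopped (h : ¬ HasInfiniteDescendingChain (Prod.fst '' φ)) :
    ∃ S : φ × ℝ → Prop, ∀ x t, S (x, t) ↔
      ∃ y : φ, CanStop x.1 y.1 ∧ along x.1 y.1 ≤ t ∧ ¬ S (y, along y.1 x.1) := by
  have wf := queryRel_wellFounded h
  refine ⟨wf.fix fun p IH => ∃ (y : φ) (h1 : CanStop p.1.1 y.1) (h2 : along p.1.1 y.1 ≤ p.2),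
    ¬ IH (y, along y.1 p.1.1) ⟨h1, h2, rfl⟩, fun x t => ?_⟩
  rw [WellFounded.fix_eq]
  simp only [exists_prop]

/-- Candidates no farther than a given one lie in a ball, so local finiteness provides an earliest
one. The value `⊤` stands for the absence of candidates. -/
theorem exists_min_canStop (hφ : IsMarkedLocallyFinite φ) (x : φ) (T : φ → Prop)
    (hT : ∀ y, T y → CanStop x.1 y.1) :
    ∃ r : ℝ≥0∞, (r = ⊤ ∧ ∀ y, ¬ T y) ∨
      ∃ y, T y ∧ r = ENNReal.ofReal (along x.1 y.1) ∧ ∀ z, T z → along x.1 y.1 ≤ along x.1 z.1 := by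
  by_cases hne : ∀ y, ¬ T y
  · exact ⟨⊤, Or.inl ⟨rfl, hne⟩⟩
  push Not at hne
  obtain ⟨y₀, hy₀⟩ := hne
  have hfin : {y : φ | T y ∧ along x.1 y.1 ≤ along x.1 y₀.1}.Finite := by
    have hB := hφ.1 (Metric.closedBall x.1.1 (2 * along x.1 y₀.1)) Metric.isBounded_closedBall
    refine Set.Finite.of_finite_image (f := Subtype.val) (hB.subset ?_) Subtype.val_injective.injOn
    rintro _ ⟨y, ⟨hy, hy'⟩, rfl⟩
    refine ⟨y.2, ?_, trivial⟩
    rw [Metric.mem_closedBall, dist_eq_norm]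
    calc _ ≤ 2 * supNorm (y.1.1 - x.1.1) := norm_le_two_mul_supNorm _
      _ = 2 * along x.1 y.1 := by rw [supNorm_sub_comm, (hT y hy).supNorm_eq]
      _ ≤ _ := by linarith
  obtain ⟨y, ⟨hy, hy'⟩, hmin⟩ := hfin.exists_minimalFor (fun y => along x.1 y.1) _ ⟨y₀, hy₀, le_rfl⟩
  refine ⟨_, Or.inr ⟨y, hy, rfl, fun z hz => ?_⟩⟩
  by_cases hzy : along x.1 z.1 ≤ along x.1 y₀.1
  · rcases le_total (along x.1 y.1) (along x.1 z.1) with h | h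
    · exact h
    · exact hmin ⟨hz, hzy⟩ h
  · linarith

/-- In a chain-free configuration in general position there is a unique length function, and a
point has finite length if some other point can stop it while being itself undisturbed. -/
theorem exists_unique_length (hφ : IsMarkedLocallyFinite φ)
    (hchain : ¬ HasInfiniteDescendingChain (Prod.fst '' φ))
    (hgen : ∀ x ∈ φ, ∀ y ∈ φ, x ≠ y → GeneralPosition x.1 y.1) :
    ∃ f : φ → ℝ≥0∞, IsLilypondLength φ f ∧ (∀ g, IsLilypondLength φ g → g = f) ∧
      ∀ x : φ, (∃ y ∈ φ, CanStop x.1 y ∧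
        ∀ z ∈ φ, z ≠ y → along y x.1 < supNorm (y.1 - z.1)) → f x < ⊤ := by
  obtain ⟨S, hS⟩ := exists_stopped hchain
  -- `f x` is the time of the earliest crossing with a stopper that is still growing there, hence
  -- the first `t` with `S (x, t)`.
  choose f hf using fun x : φ => exists_min_canStop hφ x
    (fun y => CanStop x.1 y.1 ∧ ¬ S (y, along y.1 x.1)) fun y h => h.1
  have hne : ∀ {x y : φ}, CanStop x.1 y.1 → x ≠ y := by
    rintro x _ h rfl
    exact h.1 rfl
  have hfS : ∀ x t, 0 ≤ t → (S (x, t) ↔ f x ≤ ENNReal.ofReal t) := by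
    intro x t ht
    rw [hS]
    constructor
    · rintro ⟨y, hy, hyt, hyS⟩
      rcases hf x with ⟨-, h⟩ | ⟨z, -, hz, hmin⟩
      · exact absurd ⟨hy, hyS⟩ (h y)
      · rw [hz]
        exact ENNReal.ofReal_le_ofReal ((hmin y ⟨hy, hyS⟩).trans hyt)
    · intro hle
      rcases hf x with ⟨h, -⟩ | ⟨z, ⟨hz, hzS⟩, he, hmin⟩
      · simp [h] at hle
      · exact ⟨z, hz, (ENNReal.ofReal_le_ofReal_iff ht).1 (he ▸ hle), hzS⟩
  have hkey : ∀ {x y : φ}, CanStop x.1 y.1 → ENNReal.ofReal (along y.1 x.1) < f y →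
      f x ≤ ENNReal.ofReal (along x.1 y.1) := by
    intro x y h hlt
    rw [← hfS _ _ (h.2.1.trans h.2.2.le), hS]
    exact ⟨y, h, le_rfl, by rw [hfS _ _ h.2.1]; exact not_le.2 hlt⟩
  have hcore : ∀ x y : φ, x ≠ y → Disjoint (growthSegment x (f x)) (growthSegment y (f y)) := by
    intro x y hxy
    by_contra hd
    have hg := hgen x x.2 y y.2 fun h => hxy (Subtype.ext h)
    rcases canStop_of_not_disjoint hg hd with ⟨h, hx, hy⟩ | ⟨h, hx, hy⟩
    · exact absurd (hkey h hy) (not_le.2 hx)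
    · exact absurd (hkey h hx) (not_le.2 hy)
  refine ⟨f, ⟨hcore, fun x hx => ?_⟩, fun g hg => ?_, fun x => ?_⟩
  · rcases hf x with ⟨h, -⟩ | ⟨y, ⟨hy, hyS⟩, he, hmin⟩
    · exact absurd h hx
    have ha : 0 ≤ along x.1 y.1 := hy.2.1.trans hy.2.2.le
    rw [hfS _ _ hy.2.1, not_le] at hyS
    rw [he, ENNReal.toReal_ofReal ha]
    have hmem : x.1.1 + along x.1 y.1 • x.1.2.dir ∈ growthSegment y (f y) :=
      mem_growthSegment_crossing hy.1 hy.2.1 hyS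
    refine ⟨y, ⟨hmem, ?_⟩, fun z hz => ?_⟩
    · rw [crossing_eq hy.1, add_sub_cancel_left, norm_smul, norm_dir, mul_one, Real.norm_eq_abs,
        abs_of_nonneg hy.2.1]
      exact hy.2.2
    · by_contra hzy
      exact Set.disjoint_left.1 (hcore z y hzy) hz.1 hmem
  -- Uniqueness: the hard-core and stopping properties force the same recursion on `g`, so
  -- well-founded induction identifies its sublevel sets with `S`.
  · have hgS : ∀ p : φ × ℝ, 0 ≤ p.2 → (S p ↔ g p.1 ≤ ENNReal.ofReal p.2) := by
      intro p
      refine (queryRel_wellFounded hchain).induction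
        (C := fun p => 0 ≤ p.2 → (S p ↔ g p.1 ≤ ENNReal.ofReal p.2)) p ?_
      rintro ⟨x, t⟩ IH ht
      rw [hS]
      constructor
      · rintro ⟨y, hy, hyt, hyS⟩
        rw [IH (y, along y.1 x.1) ⟨hy, hyt, rfl⟩ hy.2.1, not_le] at hyS
        by_contra hlt
        refine hy.not_disjoint ?_ hyS (hg.hardCore x y (hne hy))
        exact (ENNReal.ofReal_le_ofReal hyt).trans_lt (not_le.1 hlt)
      · intro hle
        have hfin : g x ≠ ⊤ := ne_top_of_le_ne_top ENNReal.ofReal_ne_top hle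
        obtain ⟨y, ⟨⟨c, hc0, hc, hp⟩, hlt⟩, -⟩ := hg.stopping x hfin
        have hgx : ENNReal.ofReal (g x).toReal = g x := ENNReal.ofReal_toReal hfin
        have hyc : c < (g x).toReal := by
          rw [hp, add_sub_cancel_left, norm_smul, norm_dir, mul_one, Real.norm_eq_abs,
            abs_of_nonneg hc0] at hlt
          exact hlt
        -- The end of the segment of `x` is at parameter `g x`, while the parameter `c` is smaller;
        -- so `x` is not its own stopper.
        have hxy : x ≠ y := by
          rintro rfl
          have := sub_eq_zero.2 (add_left_cancel hp)
          rw [← sub_smul, smul_eq_zero] at this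
          rcases this with h | h
          · linarith
          · have := norm_dir x.1.2
            rw [h, norm_zero] at this
            exact zero_ne_one this
        have hgp := hgen x x.2 y y.2 fun h => hxy (Subtype.ext h)
        have hax : x.1.2.1 ≠ y.1.2.1 := by
          intro hax
          obtain ⟨l, hl⟩ : ∃ l : Fin 2, l ≠ x.1.2.1 := exists_ne _
          have := congrArg (fun p : Plane => p l) hp
          simp only [PiLp.add_apply, PiLp.smul_apply, smul_eq_mul, dir_of_ne _ hl,
            dir_of_ne y.1.2 (hax ▸ hl), mul_zero, add_zero] at this
          exact hgp.1 l this
        have h1 := eq_along_of_crossing hax hp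
        have h2 := eq_along_of_crossing (Ne.symm hax) hp.symm
        have hcan : CanStop x.1 y.1 := ⟨hax, h2 ▸ hc0, by rw [← h1, ← h2]; exact hyc⟩
        have hat : along x.1 y.1 ≤ t := by
          rw [← h1]
          exact ENNReal.toReal_le_of_le_ofReal ht hle
        refine ⟨y, hcan, hat, ?_⟩
        rw [IH (y, along y.1 x.1) ⟨hcan, hat, rfl⟩ hcan.2.1, not_le, ← h2]
        exact hc
    funext x
    refine eq_of_forall_ge_iff fun c => ?_
    rcases eq_or_ne c ⊤ with rfl | hc
    · simp only [le_top]
    · have h1 := hgS (x, c.toReal) ENNReal.toReal_nonneg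
      rw [hfS _ _ ENNReal.toReal_nonneg, ENNReal.ofReal_toReal hc] at h1
      exact h1.symm
  · rintro ⟨y, hy, hcan, hiso⟩
    refine lt_of_le_of_lt (hkey (y := ⟨y, hy⟩) hcan ?_) ENNReal.ofReal_lt_top
    -- A stopper `z` of `y` acting in time would be at distance at most `along y x` from `y`,
    -- against the isolation of `y`.
    rw [← not_le, ← hfS _ _ hcan.2.1, hS]
    rintro ⟨z, hz, hzt, -⟩
    rw [← hz.supNorm_eq] at hzt
    exact absurd (hiso z z.2 fun h => hne hz (Subtype.ext h.symm)) (not_lt.2 hzt)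

end Length

/-! ### Boxes and grid cells -/

/-- The half-open box with lower corner `a` and upper corner `b`. -/
def box (a b : Fin 2 → ℝ) : Set Plane := {ξ | ∀ l, a l ≤ ξ l ∧ ξ l < b l}

theorem box_eq_preimage (a b : Fin 2 → ℝ) :
    box a b = WithLp.ofLp ⁻¹' (Set.univ.pi fun l => Set.Ico (a l) (b l)) := by
  ext ξ
  simp [box, Set.mem_pi]

theorem measurableSet_box (a b : Fin 2 → ℝ) : MeasurableSet (box a b) := by
  rw [box_eq_preimage]
  exact (PiLp.volume_preserving_ofLp (Fin 2)).measurable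
    (MeasurableSet.univ_pi fun _ => measurableSet_Ico)

theorem volume_box (a b : Fin 2 → ℝ) : volume (box a b) = ∏ l, ENNReal.ofReal (b l - a l) := by
  rw [box_eq_preimage, (PiLp.volume_preserving_ofLp (Fin 2)).measure_preimage
    (MeasurableSet.univ_pi fun _ => measurableSet_Ico).nullMeasurableSet, Real.volume_pi_Ico]

theorem isBounded_box (a b : Fin 2 → ℝ) : Bornology.IsBounded (box a b) := by
  refine isBounded_iff_forall_norm_le.2 ⟨2 * ∑ l, (|a l| + |b l|), fun ξ hξ => ?_⟩
  refine (norm_le_two_mul_supNorm ξ).trans ?_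
  rw [supNorm_eq_max, Fin.sum_univ_two]
  have key : ∀ l, |ξ l| ≤ |a l| + |b l| := by
    intro l
    have := hξ l
    rw [abs_le]
    constructor <;> linarith [neg_abs_le (a l), le_abs_self (b l), abs_nonneg (a l),
      abs_nonneg (b l)]
  have h0 := key 0
  have h1 := key 1
  have := max_le (h0.trans (le_add_of_nonneg_right ((abs_nonneg _).trans h1)))
    (h1.trans (le_add_of_nonneg_left ((abs_nonneg _).trans h0)))
  linarith

/-- The index of the grid cell of side `ε` that contains `ξ`. -/
noncomputable def idx (ε : ℝ) (ξ : Plane) : Fin 2 → ℤ := fun l => ⌊ξ l / ε⌋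

/-- The grid cell of side `ε` with index `c`. -/
def gridCell (ε : ℝ) (c : Fin 2 → ℤ) : Set Plane := {ξ | idx ε ξ = c}

theorem gridCell_eq_box {ε : ℝ} (hε : 0 < ε) (c : Fin 2 → ℤ) :
    gridCell ε c = box (fun l => c l * ε) (fun l => (c l + 1) * ε) := by
  ext ξ
  simp only [gridCell, Set.mem_ofPred_eq, funext_iff, idx, Int.floor_eq_iff, box, le_div_iff₀ hε,
    div_lt_iff₀ hε]

theorem volume_gridCell {ε : ℝ} (hε : 0 < ε) (c : Fin 2 → ℤ) :
    volume (gridCell ε c) = ENNReal.ofReal (ε ^ 2) := by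
  rw [gridCell_eq_box hε, volume_box, Fin.prod_univ_two, ← ENNReal.ofReal_mul]
  · congr 1; ring
  · ring_nf; exact hε.le

/-- The error is the difference of two fractional parts in `[0, 1)`. -/
theorem abs_idx_sub_lt (ε : ℝ) (ξ η : Plane) (l : Fin 2) :
    |((idx ε ξ l - idx ε η l : ℤ) : ℝ) - (ξ l - η l) / ε| < 1 := by
  have h1 := Int.floor_le (ξ l / ε)
  have h2 := Int.lt_floor_add_one (ξ l / ε)
  have h3 := Int.floor_le (η l / ε)
  have h4 := Int.lt_floor_add_one (η l / ε)
  rw [idx, idx, Int.cast_sub, sub_div, abs_lt]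
  constructor <;> linarith

theorem idx_ne_of_lt {ε : ℝ} (hε : 0 < ε) {ξ η : Plane} {l : Fin 2} (h : ε ≤ |ξ l - η l|) :
    idx ε ξ ≠ idx ε η := by
  intro he
  have := abs_idx_sub_lt ε ξ η l
  rw [he, sub_self, Int.cast_zero, zero_sub, abs_neg, abs_div, abs_of_pos hε, div_lt_one hε] at this
  linarith

/-! ### Poisson counts -/

section Poisson

variable {Ω : Type*} [MeasurableSpace Ω] {P : Measure Ω} {lam : ℝ≥0} {X : Ω → Set Plane}

theorem IsPoissonProcess.measure_count (hX : IsPoissonProcess P lam X) {B : Set Plane}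
    (hB : MeasurableSet B) (hb : Bornology.IsBounded B) (s : Set ℕ) :
    P {ω | (X ω ∩ B).ncard ∈ s} = poissonMeasure (lam * (volume B).toNNReal) s := by
  rw [← hX.law_count B hB hb,
    Measure.map_apply (hX.measurable_count B hB hb) (MeasurableSet.of_discrete)]
  rfl

theorem IsPoissonProcess.measure_inter_count (hX : IsPoissonProcess P lam X) {ι : Type*}
    [Fintype ι] {B : ι → Set Plane} (hB : ∀ i, MeasurableSet (B i))
    (hb : ∀ i, Bornology.IsBounded (B i)) (hd : Pairwise fun i j => Disjoint (B i) (B j))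
    (s : ι → Set ℕ) :
    P {ω | ∀ i, (X ω ∩ B i).ncard ∈ s i} = ∏ i, P {ω | (X ω ∩ B i).ncard ∈ s i} := by
  let e := (Fintype.equivFin ι).symm
  have h := hX.indep_count _ (fun k => B (e k)) (fun k => hB _) (fun k => hb _)
    (fun i j hij => hd (e.injective.ne hij))
  have h2 := (iIndepFun_iff_measure_inter_preimage_eq_mul.1 h) Finset.univ
    (sets := fun k => s (e k)) fun _ _ => MeasurableSet.of_discrete
  rw [← e.prod_comp]
  refine Eq.trans ?_ h2
  congr 1
  ext ω
  simp only [Set.mem_ofPred_eq, Finset.mem_univ, Set.iInter_true, Set.mem_iInter, Set.mem_preimage]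
  exact ⟨fun h k => h _, fun h i => by simpa using h (e.symm i)⟩

/-- This is `1 - exp (-r) ≤ r`. -/
theorem poissonMeasure_ne_zero_le (r : ℝ≥0) : poissonMeasure r {n | n ≠ 0} ≤ r := by
  have h : ({n : ℕ | n ≠ 0}) = {0}ᶜ := rfl
  rw [h, prob_compl_eq_one_sub (MeasurableSet.of_discrete), poissonMeasure_singleton,
    ← ENNReal.ofReal_one, ← ENNReal.ofReal_sub _ (by positivity), ← ENNReal.ofReal_coe_nnreal]
  apply ENNReal.ofReal_le_ofReal
  have := Real.add_one_le_exp (-(r : ℝ))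
  simp
  linarith

theorem IsPoissonProcess.nonempty_iff (hX : IsPoissonProcess P lam X) {B : Set Plane}
    (hb : Bornology.IsBounded B) (ω : Ω) : (X ω ∩ B).Nonempty ↔ (X ω ∩ B).ncard ≠ 0 := by
  rw [Ne, Set.ncard_eq_zero (hX.locallyFinite ω B hb), Set.nonempty_iff_ne_empty]

/-- First moment bound for families of grid cells which are all occupied. -/
theorem IsPoissonProcess.measure_cells_hit_le (hX : IsPoissonProcess P lam X) {ε : ℝ} (hε : 0 < ε)
    {k : ℕ} (T : Finset (Fin k → Fin 2 → ℤ)) (hT : ∀ c ∈ T, Function.Injective c) :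
    P {ω | ∃ c ∈ T, ∀ i, (X ω ∩ gridCell ε (c i)).Nonempty} ≤
      ENNReal.ofReal (T.card * (lam * ε ^ 2) ^ k) := by
  have hmeas : ∀ c, MeasurableSet (gridCell ε c) := fun c => by
    rw [gridCell_eq_box hε]; exact measurableSet_box _ _
  have hbdd : ∀ c, Bornology.IsBounded (gridCell ε c) := fun c => by
    rw [gridCell_eq_box hε]; exact isBounded_box _ _
  have hone : ∀ c, P {ω | (X ω ∩ gridCell ε c).ncard ∈ {n : ℕ | n ≠ 0}} ≤
      ENNReal.ofReal (lam * ε ^ 2) := by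
    intro c
    rw [hX.measure_count (hmeas c) (hbdd c), volume_gridCell hε]
    refine (poissonMeasure_ne_zero_le _).trans_eq ?_
    rw [ENNReal.coe_mul, ENNReal.coe_toNNReal ENNReal.ofReal_ne_top,
      ENNReal.ofReal_mul (NNReal.coe_nonneg _), ENNReal.ofReal_coe_nnreal]
  calc P {ω | ∃ c ∈ T, ∀ i, (X ω ∩ gridCell ε (c i)).Nonempty}
      = P (⋃ c ∈ T, {ω | ∀ i, (X ω ∩ gridCell ε (c i)).ncard ∈ {n : ℕ | n ≠ 0}}) := by
        congr 1
        ext ω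
        simp only [Set.mem_ofPred_eq, Set.mem_iUnion, hX.nonempty_iff (hbdd _), exists_prop]
    _ ≤ ∑ c ∈ T, P {ω | ∀ i, (X ω ∩ gridCell ε (c i)).ncard ∈ {n : ℕ | n ≠ 0}} :=
        measure_biUnion_finset_le _ _
    _ ≤ ∑ c ∈ T, ENNReal.ofReal (lam * ε ^ 2) ^ k := by
        refine Finset.sum_le_sum fun c hc => ?_
        rw [hX.measure_inter_count (fun i => hmeas _) (fun i => hbdd _) (fun i j hij => ?_)
          (fun _ => {n : ℕ | n ≠ 0})]
        · refine (Finset.prod_le_prod' fun i _ => hone (c i)).trans_eq ?_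
          rw [Finset.prod_const, Finset.card_univ, Fintype.card_fin]
        · refine Set.disjoint_left.2 fun ξ h1 h2 => hT c hc |>.ne hij ?_
          exact h1.symm.trans h2
    _ = _ := by
        rw [Finset.sum_const, nsmul_eq_mul, ENNReal.ofReal_mul (Nat.cast_nonneg _),
          ENNReal.ofReal_natCast, ENNReal.ofReal_pow (by positivity)]

/-- Fatou's lemma for sets: `A` lies in the lower limit of the `B N`. Only an outer bound is used,
so `A` need not be measurable. -/
theorem measure_le_of_eventually_mem {A : Set Ω} {B : ℕ → Set Ω} {u : ℕ → ℝ≥0∞} {L : ℝ≥0∞}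
    (h : ∀ ω ∈ A, ∀ᶠ N in Filter.atTop, ω ∈ B N) (hB : ∀ N, P (B N) ≤ u N)
    (hu : Filter.Tendsto u Filter.atTop (nhds L)) : P A ≤ L := by
  have hsub : A ⊆ ⋃ M, ⋂ N ≥ M, B N := by
    intro ω hω
    obtain ⟨M, hM⟩ := Filter.eventually_atTop.1 (h ω hω)
    exact Set.mem_iUnion.2 ⟨M, Set.mem_iInter₂.2 fun N hN => hM N hN⟩
  have hmono : Monotone fun M => ⋂ N ≥ M, B N := fun M M' hM =>
    Set.iInter₂_mono' fun N hN => ⟨N, le_trans hM hN, le_rfl⟩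
  refine (measure_mono hsub).trans ?_
  rw [hmono.measure_iUnion]
  refine iSup_le fun M => ge_of_tendsto hu ?_
  filter_upwards [Filter.eventually_ge_atTop M] with N hN
  exact (measure_mono (Set.iInter₂_subset N hN)).trans (hB N)

end Poisson

/-! ### Counting discrete chains -/

/-- The maximum norm of an integer vector. -/
def size (d : Fin 2 → ℤ) : ℕ := max (d 0).natAbs (d 1).natAbs

/-- The integer vectors of maximum norm at most `M`. -/
noncomputable def ballFinset (M : ℕ) : Finset (Fin 2 → ℤ) :=
  Fintype.piFinset fun _ => Finset.Icc (-(M : ℤ)) M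

theorem mem_ballFinset {M : ℕ} {d : Fin 2 → ℤ} : d ∈ ballFinset M ↔ size d ≤ M := by
  simp only [ballFinset, Fintype.mem_piFinset, Finset.mem_Icc, Fin.forall_fin_two, size]
  omega

theorem card_ballFinset (M : ℕ) : (ballFinset M).card = (2 * M + 1) ^ 2 := by
  simp only [ballFinset, Fintype.card_piFinset, Int.card_Icc, Finset.prod_const, Finset.card_univ,
    Fintype.card_fin]
  congr 1
  omega

/-- The shell of norm `M + 1` has `(2M + 3)² - (2M + 1)² = 8 (M + 1)` points. -/
theorem sum_ballFinset_succ (F : ℕ → ℝ) (M : ℕ) :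
    ∑ d ∈ ballFinset (M + 1), F (size d) =
      ∑ d ∈ ballFinset M, F (size d) + 8 * (M + 1) * F (M + 1) := by
  have hsub : ballFinset M ⊆ ballFinset (M + 1) := fun d hd => by
    rw [mem_ballFinset] at hd ⊢; omega
  rw [← Finset.sum_sdiff hsub, add_comm]
  congr 1
  have : ∀ d ∈ ballFinset (M + 1) \ ballFinset M, F (size d) = F (M + 1) := by
    intro d hd
    rw [Finset.mem_sdiff, mem_ballFinset, mem_ballFinset] at hd
    congr 1
    omega
  rw [Finset.sum_congr rfl this, Finset.sum_const, Finset.card_sdiff_of_subset hsub,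
    card_ballFinset, card_ballFinset, nsmul_eq_mul, Nat.cast_sub (by gcongr; omega)]
  push_cast
  ring

/-- The difference of powers is `a - b` times a sum of `n + 1` terms, each at least `b ^ n`. It
plays the role of integrating `x ^ n` and is the source of the factorial. -/
theorem mul_pow_le_pow_sub_pow {a b : ℝ} (hb : 0 ≤ b) (hab : b ≤ a) (n : ℕ) :
    (n + 1) * (a - b) * b ^ n ≤ a ^ (n + 1) - b ^ (n + 1) := by
  induction n with
  | zero => simp
  | succ n ih =>
    have h1 : b ^ (n + 1) ≤ a ^ (n + 1) := pow_le_pow_left₀ hb hab _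
    have h2 := mul_le_mul_of_nonneg_left ih hb
    have h3 := mul_le_mul_of_nonneg_left h1 (sub_nonneg.2 hab)
    push_cast
    calc (n + 1 + 1) * (a - b) * b ^ (n + 1)
        = b * ((n + 1) * (a - b) * b ^ n) + (a - b) * b ^ (n + 1) := by ring
      _ ≤ b * (a ^ (n + 1) - b ^ (n + 1)) + (a - b) * a ^ (n + 1) := by linarith
      _ = _ := by ring

/-- Summation over shells telescopes against `(2M + C)^(2(n+1)) / (n+1)!`, as in the comparison of a
sum with an integral. -/
theorem sum_ballFinset_pow_le {C : ℝ} (hC : 0 ≤ C) (n M : ℕ) :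
    ∑ d ∈ ballFinset M, (2 * (size d : ℝ) + C) ^ (2 * n) / n.factorial ≤
      (2 * M + C + 2) ^ (2 * (n + 1)) / (n + 1).factorial := by
  -- The squares of `2M + C + 2` and `2M + C` differ by `8M + 4C + 4`. This dominates the shell
  -- cardinality `8M`, and `4C + 4` is enough for the single vector at the centre.
  have hstep : ∀ M : ℕ, 8 * (M : ℝ) * ((2 * M + C) ^ (2 * n) / n.factorial) ≤
      (2 * M + C + 2) ^ (2 * (n + 1)) / (n + 1).factorial -
        (2 * M + C) ^ (2 * (n + 1)) / (n + 1).factorial ∧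
      (2 * (M : ℝ) + C) ^ (2 * n) / n.factorial * (4 * C + 4) ≤
      (2 * M + C + 2) ^ (2 * (n + 1)) / (n + 1).factorial -
        (2 * M + C) ^ (2 * (n + 1)) / (n + 1).factorial := by
    intro M
    have hM : (0 : ℝ) ≤ 2 * M + C := by positivity
    have h := mul_pow_le_pow_sub_pow (a := (2 * M + C + 2) ^ 2) (b := (2 * M + C) ^ 2)
      (by positivity) (pow_le_pow_left₀ hM (by linarith) 2) n
    rw [← pow_mul, ← pow_mul, ← pow_mul] at h
    have hf : (0 : ℝ) < n.factorial := by positivity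
    have hp : 0 ≤ (2 * M + C) ^ (2 * n) := by positivity
    have hn : (0 : ℝ) < n + 1 := by positivity
    rw [← sub_div, Nat.factorial_succ, Nat.cast_mul, Nat.cast_succ]
    constructor
    · rw [le_div_iff₀ (by positivity)]
      calc _ = (n + 1) * (8 * M) * (2 * M + C) ^ (2 * n) := by field_simp
        _ ≤ (n + 1) * ((2 * M + C + 2) ^ 2 - (2 * M + C) ^ 2) * (2 * M + C) ^ (2 * n) := by
            gcongr
            nlinarith
        _ ≤ _ := h
    · rw [le_div_iff₀ (by positivity)]
      calc _ = (n + 1) * (4 * C + 4) * (2 * M + C) ^ (2 * n) := by field_simp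
        _ ≤ (n + 1) * ((2 * M + C + 2) ^ 2 - (2 * M + C) ^ 2) * (2 * M + C) ^ (2 * n) := by
            gcongr
            nlinarith [(Nat.cast_nonneg M : (0 : ℝ) ≤ M)]
        _ ≤ _ := h
  induction M with
  | zero =>
    have h0 : ballFinset 0 = {0} := by
      apply Finset.eq_singleton_iff_unique_mem.2
      refine ⟨by simp [mem_ballFinset, size], fun d hd => ?_⟩
      rw [mem_ballFinset, size] at hd
      ext l
      fin_cases l <;> simp <;> omega
    have h := (hstep 0).2
    rw [h0, Finset.sum_singleton]
    simp only [size, Pi.zero_apply, Int.natAbs_zero, max_self, Nat.cast_zero, mul_zero,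
      zero_add] at h ⊢
    have h1 : 0 ≤ C ^ (2 * n) / n.factorial := by positivity
    have h2 : 0 ≤ C ^ (2 * (n + 1)) / (n + 1).factorial := by positivity
    nlinarith
  | succ M ih =>
    have h := (hstep (M + 1)).1
    rw [sum_ballFinset_succ fun k => (2 * (k : ℝ) + C) ^ (2 * n) / n.factorial]
    push_cast at h ⊢
    have e : 2 * ((M : ℝ) + 1) + C = 2 * M + C + 2 := by ring
    rw [e] at h ⊢
    linarith

/-- Discrete chains with `n` steps which start in `c`, whose first step is at most `M` and whose
step sizes increase by at most one. -/
noncomputable def chainFinset : (n : ℕ) → ℕ → (Fin 2 → ℤ) → Finset (Fin (n + 1) → Fin 2 → ℤ)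
  | 0, _, c => {fun _ => c}
  | n + 1, M, c => (ballFinset M).biUnion fun d =>
      (chainFinset n (size d + 1) (c + d)).image fun x => (Fin.cons c x : Fin (n + 2) → Fin 2 → ℤ)

/-- Each step adds four to the base: two from the rounding allowance `size d + 1`, two from the
shift in `sum_ballFinset_pow_le`. -/
theorem card_chainFinset_le (n : ℕ) : ∀ (M : ℕ) (c : Fin 2 → ℤ),
    ((chainFinset n M c).card : ℝ) ≤ (2 * M + 4 * n) ^ (2 * n) / n.factorial := by
  induction n with
  | zero => intro M c; simp [chainFinset]
  | succ n ih =>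
    intro M c
    calc ((chainFinset (n + 1) M c).card : ℝ)
        ≤ ∑ d ∈ ballFinset M, ((chainFinset n (size d + 1) (c + d)).card : ℝ) := by
          rw [← Nat.cast_sum, Nat.cast_le]
          exact Finset.card_biUnion_le.trans (Finset.sum_le_sum fun d _ => Finset.card_image_le)
      _ ≤ ∑ d ∈ ballFinset M, (2 * (size d : ℝ) + (4 * n + 2)) ^ (2 * n) / n.factorial := by
          refine Finset.sum_le_sum fun d _ => (ih _ _).trans_eq ?_
          congr 2
          push_cast
          ring
      _ ≤ _ := sum_ballFinset_pow_le (by positivity) n M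
      _ = _ := by congr 2; push_cast; ring

theorem mem_chainFinset (n : ℕ) : ∀ (M : ℕ) (c : ℕ → Fin 2 → ℤ),
    (1 ≤ n → size (c 1 - c 0) ≤ M) →
    (∀ i, i + 2 ≤ n → size (c (i + 2) - c (i + 1)) ≤ size (c (i + 1) - c i) + 1) →
    (fun i : Fin (n + 1) => c i) ∈ chainFinset n M (c 0) := by
  induction n with
  | zero =>
    intro M c _ _
    rw [chainFinset, Finset.mem_singleton]
    funext i
    rw [Fin.eq_zero i]
    rfl
  | succ n ih =>
    intro M c h1 h2
    rw [chainFinset, Finset.mem_biUnion]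
    refine ⟨c 1 - c 0, mem_ballFinset.2 (h1 (by omega)), Finset.mem_image.2
      ⟨fun i => c (i + 1), ?_, ?_⟩⟩
    · rw [add_sub_cancel]
      exact ih _ (fun i => c (i + 1)) (fun hn => h2 0 (by omega)) fun i hi => h2 (i + 1) (by omega)
    · funext i
      refine Fin.cases rfl (fun i => ?_) i
      simp

/-! ### The chain estimate -/

theorem cast_size (d : Fin 2 → ℤ) : (size d : ℝ) = max |(d 0 : ℝ)| |(d 1 : ℝ)| := by
  rw [size, Nat.cast_max, Nat.cast_natAbs, Nat.cast_natAbs, Int.cast_abs, Int.cast_abs]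

/-- Coordinatewise errors below one pass to the maximum. Hence a strict decrease of distances lets
the integer sizes grow by at most one. -/
theorem abs_size_sub_lt {ε : ℝ} (hε : 0 < ε) (ξ η : Plane) :
    |(size (idx ε ξ - idx ε η) : ℝ) - supNorm (ξ - η) / ε| < 1 := by
  have key : ∀ l, |((idx ε ξ - idx ε η) l : ℝ)| < |(ξ - η) l| / ε + 1 ∧
      |(ξ - η) l| / ε < |((idx ε ξ - idx ε η) l : ℝ)| + 1 := by
    intro l
    have h := (abs_abs_sub_abs_le _ _).trans_lt (abs_idx_sub_lt ε ξ η l)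
    rw [abs_div, abs_of_pos hε, abs_lt] at h
    refine ⟨?_, ?_⟩ <;> simp only [PiLp.sub_apply, Pi.sub_apply] <;> linarith
  obtain ⟨h1, h2⟩ := key 0
  obtain ⟨h3, h4⟩ := key 1
  rw [cast_size, supNorm_eq_max, ← max_div_div_right hε.le, abs_lt]
  constructor
  · rw [neg_lt_sub_iff_lt_add]
    apply max_lt
    · linarith [le_max_left |((idx ε ξ - idx ε η) 0 : ℝ)| |((idx ε ξ - idx ε η) 1 : ℝ)|]
    · linarith [le_max_right |((idx ε ξ - idx ε η) 0 : ℝ)| |((idx ε ξ - idx ε η) 1 : ℝ)|]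
  · rw [sub_lt_iff_lt_add']
    apply max_lt
    · linarith [le_max_left (|(ξ - η) 0| / ε) (|(ξ - η) 1| / ε)]
    · linarith [le_max_right (|(ξ - η) 0| / ε) (|(ξ - η) 1| / ε)]

/-- The indices of the grid cells of side `ε` which meet the square of side `s`. -/
noncomputable def squareIdx (s ε : ℝ) : Finset (Fin 2 → ℤ) :=
  Fintype.piFinset fun _ => Finset.Icc ⌊-s / 2 / ε⌋ ⌊s / 2 / ε⌋

theorem idx_mem_Icc {s ε : ℝ} (hε : 0 < ε) {ξ : Plane} (h : ξ ∈ square s) (l : Fin 2) :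
    idx ε ξ l ∈ Finset.Icc ⌊-s / 2 / ε⌋ ⌊s / 2 / ε⌋ := by
  have := h l
  rw [Finset.mem_Icc]
  exact ⟨Int.floor_le_floor (by gcongr; exact this.1), Int.floor_le_floor (by gcongr; exact this.2)⟩

theorem idx_mem_squareIdx {s ε : ℝ} (hε : 0 < ε) {ξ : Plane} (h : ξ ∈ square s) :
    idx ε ξ ∈ squareIdx s ε := Fintype.mem_piFinset.2 fun l => idx_mem_Icc hε h l

theorem card_Icc_floor_le {s ε : ℝ} (hs : 0 ≤ s) (hε : 0 < ε) :
    ((Finset.Icc ⌊-s / 2 / ε⌋ ⌊s / 2 / ε⌋).card : ℝ) ≤ s / ε + 2 := by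
  rw [Int.card_Icc]
  have h1 := Int.floor_le (s / 2 / ε)
  have h2 := Int.lt_floor_add_one (-s / 2 / ε)
  have h3 : s / 2 / ε - -s / 2 / ε = s / ε := by field_simp; ring
  have h4 : 0 ≤ s / ε := by positivity
  have h5 : (((⌊s / 2 / ε⌋ + 1 - ⌊-s / 2 / ε⌋).toNat : ℤ) : ℝ) ≤ s / ε + 2 := by
    rw [Int.toNat_eq_max, Int.cast_max]
    refine max_le ?_ (by simp; linarith)
    push_cast
    linarith
  exact_mod_cast h5

theorem card_squareIdx_le {s ε : ℝ} (hs : 0 ≤ s) (hε : 0 < ε) :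
    ((squareIdx s ε).card : ℝ) ≤ (s / ε + 2) ^ 2 := by
  rw [squareIdx, Fintype.card_piFinset, Finset.prod_const, Finset.card_univ, Fintype.card_fin,
    Nat.cast_pow]
  exact pow_le_pow_left₀ (Nat.cast_nonneg _) (card_Icc_floor_le hs hε) 2

theorem eventually_injOn_idx (x : ℕ → Plane) (n : ℕ) (hx : Set.InjOn x {i | i ≤ n}) :
    ∀ᶠ N : ℕ in Filter.atTop,
      Function.Injective fun i : Fin (n + 1) => idx (1 / ((N : ℝ) + 1)) (x i) := by
  have h : ∀ i j : Fin (n + 1), ∀ᶠ N : ℕ in Filter.atTop, i ≠ j →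
      idx (1 / ((N : ℝ) + 1)) (x i) ≠ idx (1 / ((N : ℝ) + 1)) (x j) := by
    intro i j
    by_cases hij : i = j
    · exact Filter.Eventually.of_forall fun N h => absurd hij h
    have hne : x i ≠ x j := fun h => hij <| Fin.ext <| hx (by simp; omega) (by simp; omega) h
    obtain ⟨l, hl⟩ : ∃ l, x i l ≠ x j l := by
      by_contra! h
      exact hne (PiLp.ext h)
    filter_upwards [tendsto_one_div_add_atTop_nhds_zero_nat.eventually_le_const
      (abs_pos.2 (sub_ne_zero.2 hl))] with N hN _
    exact idx_ne_of_lt (by positivity) hN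
  filter_upwards [Filter.eventually_all.2 fun i => Filter.eventually_all.2 fun j => h i j]
    with N hN i j hij
  by_contra hne
  exact hN i j hne hij

section Chain

variable {Ω : Type*} [MeasurableSpace Ω] {P : Measure Ω} {lam : ℝ≥0} {X : Ω → Set Plane}

open Classical in
theorem IsPoissonProcess.measure_chainEvent_le (hX : IsPoissonProcess P lam X) (n : ℕ) {b s : ℝ}
    (hb : 0 < b) (hs : 0 < s) :
    P (chainEvent X s b n) ≤
      ENNReal.ofReal (s ^ 2 * (4 * b ^ 2) ^ n * (lam : ℝ) ^ (n + 1) / (n.factorial : ℝ)) := by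
  let ε : ℕ → ℝ := fun N => 1 / ((N : ℝ) + 1)
  have hε : ∀ N, 0 < ε N := fun N => by positivity
  have hε0 : Filter.Tendsto ε Filter.atTop (nhds 0) := tendsto_one_div_add_atTop_nhds_zero_nat
  let T : ℕ → Finset (Fin (n + 1) → Fin 2 → ℤ) := fun N =>
    ((squareIdx s (ε N)).biUnion fun c => chainFinset n (⌊b / ε N⌋₊ + 1) c).filter
      Function.Injective
  refine measure_le_of_eventually_mem
    (B := fun N => {ω | ∃ c ∈ T N, ∀ i, (X ω ∩ gridCell (ε N) (c i)).Nonempty})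
    -- The counting bound times `(λ ε²)^(n+1)` with all negative powers of `ε` cancelled; at `ε = 0`
    -- it is the claimed value because `(2b)^(2n) = (4b²)^n`.
    (u := fun N => ENNReal.ofReal ((s + 2 * ε N) ^ 2 * (2 * b + (4 * n + 2) * ε N) ^ (2 * n) *
      (lam : ℝ) ^ (n + 1) / (n.factorial : ℝ))) ?_ (fun N => ?_) ?_
  · rintro ω ⟨x, hinj, h0, hmem, hb1, hdesc⟩
    filter_upwards [eventually_injOn_idx x n hinj] with N hN
    have hsz := fun i => abs_lt.1 (abs_size_sub_lt (hε N) (x (i + 1)) (x i))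
    refine ⟨fun i => idx (ε N) (x i), Finset.mem_filter.2 ⟨Finset.mem_biUnion.2
      ⟨_, idx_mem_squareIdx (hε N) h0, mem_chainFinset n _ (fun i => idx (ε N) (x i)) ?_ ?_⟩, hN⟩,
      fun i => ⟨x i, hmem i (by exact_mod_cast i.2), rfl⟩⟩
    · intro hn
      have h1 := (hsz 0).2
      have h2 := hb1 (by exact_mod_cast (by omega : 1 < n + 1))
      rw [supNorm_sub_comm] at h2
      have h3 : supNorm (x (0 + 1) - x 0) / ε N ≤ b / ε N :=
        div_le_div_of_nonneg_right h2 (hε N).le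
      have h4 := Nat.lt_floor_add_one (b / ε N)
      have h5 : (size (idx (ε N) (x 1) - idx (ε N) (x 0)) : ℝ) < ⌊b / ε N⌋₊ + 1 + 1 := by
        simp only [zero_add] at h1 h3
        linarith
      exact Nat.lt_succ_iff.1 (by exact_mod_cast h5)
    · intro i hi
      have h1 := (hsz (i + 1)).2
      have h2 := (hsz i).1
      have h3 := hdesc i (by exact_mod_cast (by omega : i + 2 < n + 1))
      rw [supNorm_sub_comm, supNorm_sub_comm (x i)] at h3
      have h4 := div_lt_div_of_pos_right h3 (hε N)
      have h5 : (size (idx (ε N) (x (i + 2)) - idx (ε N) (x (i + 1))) : ℝ) <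
          size (idx (ε N) (x (i + 1)) - idx (ε N) (x i)) + 1 + 1 := by
        linarith
      exact Nat.lt_succ_iff.1 (by exact_mod_cast h5)
  · refine (hX.measure_cells_hit_le (hε N) (T N) fun c hc => (Finset.mem_filter.1 hc).2).trans ?_
    apply ENNReal.ofReal_le_ofReal
    have hcard : ((T N).card : ℝ) ≤
        (s / ε N + 2) ^ 2 * ((2 * (b / ε N + 1) + 4 * n) ^ (2 * n) / n.factorial) := by
      calc ((T N).card : ℝ)
          ≤ ∑ c ∈ squareIdx s (ε N), ((chainFinset n (⌊b / ε N⌋₊ + 1) c).card : ℝ) := by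
            rw [← Nat.cast_sum, Nat.cast_le]
            exact (Finset.card_filter_le _ _).trans Finset.card_biUnion_le
        _ ≤ ∑ c ∈ squareIdx s (ε N), (2 * (b / ε N + 1) + 4 * n) ^ (2 * n) / n.factorial := by
            refine Finset.sum_le_sum fun c _ => (card_chainFinset_le _ _ _).trans ?_
            have := Nat.floor_le (div_nonneg hb.le (hε N).le)
            push_cast
            gcongr
        _ ≤ _ := by
            rw [Finset.sum_const, nsmul_eq_mul]
            have := div_nonneg hb.le (hε N).le
            exact mul_le_mul_of_nonneg_right (card_squareIdx_le hs.le (hε N)) (by positivity)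
    refine (mul_le_mul_of_nonneg_right hcard (by positivity)).trans_eq ?_
    have he := (hε N).ne'
    have e1 : s / ε N + 2 = (s + 2 * ε N) / ε N := by field_simp
    have e2 : 2 * (b / ε N + 1) + 4 * n = (2 * b + (4 * n + 2) * ε N) / ε N := by field_simp; ring
    have e3 : (ε N ^ 2) ^ (n + 1) = ε N ^ 2 * ε N ^ (2 * n) := by ring
    clear_value ε
    rw [e1, e2, div_pow, div_pow, mul_pow, e3]
    field_simp
  · apply ENNReal.tendsto_ofReal
    have hc : Continuous fun e : ℝ => (s + 2 * e) ^ 2 * (2 * b + (4 * n + 2) * e) ^ (2 * n) *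
      (lam : ℝ) ^ (n + 1) / (n.factorial : ℝ) := by fun_prop
    have := (hc.tendsto 0).comp hε0
    simp only [mul_zero, add_zero] at this
    have e : (4 * b ^ 2) ^ n = (2 * b) ^ (2 * n) := by rw [pow_mul]; congr 1; ring
    rw [e]
    exact this

/-! ### Absence of infinite chains -/

/-- Erasing loops turns an infinite chain into one without repetitions. -/
theorem exists_injective_chain {φ : Set Plane} (hφ : LocallyFiniteSet φ) {b : ℝ} {x : ℕ → Plane}
    (hx : IsBoundedDescendingChain φ b ⊤ x) :
    ∃ y : ℕ → Plane, Function.Injective y ∧ y 0 = x 0 ∧ IsBoundedDescendingChain φ b ⊤ y := by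
  obtain ⟨hmem, hb, hdesc⟩ := hx
  replace hmem : ∀ i, x i ∈ φ := fun i => hmem i (ENat.natCast_lt_top i)
  replace hb : supNorm (x 0 - x 1) ≤ b := hb (ENat.natCast_lt_top 1)
  have hanti : StrictAnti fun i => supNorm (x i - x (i + 1)) :=
    strictAnti_nat_of_succ_lt fun i => hdesc i (ENat.natCast_lt_top _)
  have hle : ∀ i, supNorm (x i - x (i + 1)) ≤ b := fun i => (hanti.antitone (Nat.zero_le i)).trans hb
  -- No point is visited infinitely often: the successors of its visits stay in a ball and are
  -- distinct, since step lengths are strictly decreasing.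
  have hfin : ∀ t, {u | x u = x t}.Finite := by
    intro t
    refine Set.Finite.of_finite_image (f := fun u => x (u + 1))
      ((hφ (Metric.closedBall (x t) (2 * b)) Metric.isBounded_closedBall).subset ?_) ?_
    · rintro _ ⟨u, hu, rfl⟩
      refine ⟨hmem _, ?_⟩
      rw [Metric.mem_closedBall, dist_comm, dist_eq_norm, ← show x u = x t from hu]
      exact (norm_le_two_mul_supNorm _).trans (by linarith [hle u])
    · intro u hu v hv huv
      apply hanti.injective
      simp only at huv ⊢
      rw [huv, show x u = x t from hu, show x v = x t from hv]
  have hlast : ∀ t, ∃ u, t ≤ u ∧ x u = x t ∧ ∀ v, u < v → x v ≠ x t := by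
    intro t
    obtain ⟨u, hu, hmax⟩ := (hfin t).exists_maximal ⟨t, rfl⟩
    have hmax' : ∀ v, x v = x t → v ≤ u := fun v hv => by
      rcases le_total v u with h | h
      · exact h
      · exact hmax hv h
    exact ⟨u, hmax' t rfl, hu, fun v huv hv => absurd (hmax' v hv) (not_le.2 huv)⟩
  choose L hL1 hL2 hL3 using hlast
  let τ : ℕ → ℕ := fun i => Nat.rec (L 0) (fun _ t => L (t + 1)) i
  have hτ : ∀ i, τ (i + 1) = L (τ i + 1) := fun i => rfl
  have hmono : StrictMono τ := strictMono_nat_of_lt_succ fun i => (hL1 (τ i + 1) : _ ≤ τ (i + 1))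
  have hlastτ : ∀ i v, τ i < v → x v ≠ x (τ i) := by
    intro i v hv
    cases i with
    | zero => exact fun h => hL3 0 v hv (h.trans (hL2 0))
    | succ i => exact fun h => hL3 (τ i + 1) v hv (h.trans (hL2 (τ i + 1)))
  have hnext : ∀ i, x (τ (i + 1)) = x (τ i + 1) := fun i => hL2 (τ i + 1)
  refine ⟨fun i => x (τ i), fun i j hij => ?_, hL2 0, fun i _ => hmem _, fun _ => ?_, fun i _ => ?_⟩
  · rcases lt_trichotomy i j with h | h | h
    · exact absurd hij.symm (hlastτ i _ (hmono h))
    · exact h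
    · exact absurd hij (hlastτ j _ (hmono h))
  · simp only
    rw [show x (τ 1) = x (τ 0 + 1) from hnext 0]
    exact hle _
  · simp only
    have h : supNorm (x (τ (i + 1)) - x (τ (i + 1) + 1)) < supNorm (x (τ i) - x (τ i + 1)) :=
      hanti (hmono (Nat.lt_succ_self i))
    rw [hnext (i + 1)]
    rwa [← hnext i] at h

/-- For fixed `b = s = K + 1` the chain bound is a constant times `cⁿ / n!`, which tends to zero. A
loop-free infinite chain realizes the events for all `n` once `K` is large. -/
theorem IsPoissonProcess.ae_no_chain (hX : IsPoissonProcess P lam X) :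
    ∀ᵐ ω ∂P, ¬ HasInfiniteDescendingChain (X ω) := by
  have hzero : ∀ K : ℕ, P (⋂ n, chainEvent X (K + 1) (K + 1) n) = 0 := by
    intro K
    have hK : (0 : ℝ) < K + 1 := by positivity
    refine le_antisymm ?_ (zero_le)
    refine measure_le_of_eventually_mem (B := fun n => chainEvent X (K + 1) (K + 1) n)
      (fun ω hω => Filter.Eventually.of_forall fun n => Set.mem_iInter.1 hω n)
      (fun n => hX.measure_chainEvent_le n hK hK) ?_
    rw [← ENNReal.ofReal_zero]
    apply ENNReal.tendsto_ofReal
    have h := (FloorSemiring.tendsto_pow_div_factorial_atTop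
      (4 * ((K : ℝ) + 1) ^ 2 * lam)).const_mul (((K : ℝ) + 1) ^ 2 * lam)
    rw [mul_zero] at h
    refine h.congr fun n => ?_
    rw [mul_pow (4 * ((K : ℝ) + 1) ^ 2), pow_succ (lam : ℝ)]
    ring
  filter_upwards [ae_all_iff.2 fun K => measure_eq_zero_iff_ae_notMem.1 (hzero K)] with ω hω
  rintro ⟨b, -, x, hx⟩
  obtain ⟨y, hinj, -, hmem, hb, hdesc⟩ := exists_injective_chain (hX.locallyFinite ω) hx
  obtain ⟨K, hK⟩ := exists_nat_ge (max b (2 * supNorm (y 0)))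
  refine hω K (Set.mem_iInter.2 fun n => ⟨y, hinj.injOn, fun l => ?_, fun i _ => hmem i
    (ENat.natCast_lt_top i), fun _ => (hb (ENat.natCast_lt_top 1)).trans ?_, fun i _ => hdesc i
    (ENat.natCast_lt_top _)⟩)
  · have h1 := (le_max_right _ _).trans hK
    have h2 := abs_le.1 (abs_apply_le_supNorm (y 0) l)
    constructor <;> linarith
  · have := (le_max_left _ _).trans hK
    linarith

/-! ### General position -/

open Classical in
theorem IsPoissonProcess.measure_degenerate_pair (hX : IsPoissonProcess P lam X) {l l' : Fin 2}
    (hl : l ≠ l') {γ : ℤ} (hγ : |γ| ≤ 1) {s : ℝ} (hs : 0 < s) :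
    P {ω | ∃ ξ ∈ X ω, ∃ η ∈ X ω, ξ ≠ η ∧ ξ ∈ square s ∧ η ∈ square s ∧
      (ξ l - η l) + γ * (ξ l' - η l') = 0} = 0 := by
  let ε : ℕ → ℝ := fun N => 1 / ((N : ℝ) + 1)
  have hε : ∀ N, 0 < ε N := fun N => by positivity
  have hε0 : Filter.Tendsto ε Filter.atTop (nhds 0) := tendsto_one_div_add_atTop_nhds_zero_nat
  let T : ℕ → Finset (Fin 2 → Fin 2 → ℤ) := fun N =>
    (Fintype.piFinset fun _ => squareIdx s (ε N)).filter fun c => Function.Injective c ∧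
      |(c 0 l - c 1 l) + γ * (c 0 l' - c 1 l')| ≤ 1
  refine le_antisymm (measure_le_of_eventually_mem
    (B := fun N => {ω | ∃ c ∈ T N, ∀ i, (X ω ∩ gridCell (ε N) (c i)).Nonempty})
    (u := fun N => ENNReal.ofReal (3 * lam ^ 2 * (s + 2 * ε N) ^ 3 * ε N)) ?_ (fun N => ?_) ?_)
    zero_le
  · rintro ω ⟨ξ, hξ, η, hη, hne, hξs, hηs, hdeg⟩
    have hinj : Set.InjOn (fun i : ℕ => if i = 0 then ξ else η) {i | i ≤ 1} := by
      intro i hi j hj hij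
      have hi : i ≤ 1 := hi
      have hj : j ≤ 1 := hj
      by_cases h : i = 0 <;> by_cases h' : j = 0
      · rw [h, h']
      · exact absurd (by simpa [h, h'] using hij) hne
      · exact absurd (by simpa [h, h'] using hij.symm) hne
      · omega
    filter_upwards [eventually_injOn_idx _ 1 hinj] with N hN
    refine ⟨_, Finset.mem_filter.2 ⟨Fintype.mem_piFinset.2 fun i => ?_, hN, ?_⟩, fun i => ?_⟩
    · fin_cases i
      · exact idx_mem_squareIdx (hε N) hξs
      · exact idx_mem_squareIdx (hε N) hηs
    · have h1 := abs_lt.1 (abs_idx_sub_lt (ε N) ξ η l)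
      have h2 := abs_idx_sub_lt (ε N) ξ η l'
      have h3 : |(γ : ℝ) * (((idx (ε N) ξ l' - idx (ε N) η l' : ℤ) : ℝ) - (ξ l' - η l') / ε N)| < 1 := by
        rw [abs_mul]
        have : |(γ : ℝ)| ≤ 1 := by exact_mod_cast hγ
        exact (mul_le_of_le_one_left (abs_nonneg _) this).trans_lt h2
      have h4 := abs_lt.1 h3
      have h5 : (ξ l - η l) / ε N + γ * ((ξ l' - η l') / ε N) = 0 := by
        rw [← mul_div_assoc, ← add_div, hdeg, zero_div]
      have h6 : |((idx (ε N) ξ l - idx (ε N) η l + γ * (idx (ε N) ξ l' - idx (ε N) η l') : ℤ) : ℝ)|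
          < 2 := by
        push_cast at h1 h4 ⊢
        rw [abs_lt]
        constructor <;> linarith
      have h7 : |idx (ε N) ξ l - idx (ε N) η l + γ * (idx (ε N) ξ l' - idx (ε N) η l')| < 2 := by
        exact_mod_cast h6
      exact Int.lt_add_one_iff.1 h7
    · fin_cases i
      · exact ⟨ξ, hξ, rfl⟩
      · exact ⟨η, hη, rfl⟩
  · refine (hX.measure_cells_hit_le (hε N) (T N) fun c hc => (Finset.mem_filter.1 hc).2.1).trans ?_
    apply ENNReal.ofReal_le_ofReal
    -- The first cell, one coordinate of the second and the rounded relation determine the pair. The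
    -- relation takes three values: as `|γ| ≤ 1`, its rounding error is below two, and `γ` is an
    -- integer.
    have hcard : (T N).card ≤ (squareIdx s (ε N) ×ˢ (Finset.Icc ⌊-s / 2 / ε N⌋ ⌊s / 2 / ε N⌋ ×ˢ
        Finset.Icc (-1 : ℤ) 1)).card := by
      refine Finset.card_le_card_of_injOn
        (fun c => (c 0, c 1 l', (c 0 l - c 1 l) + γ * (c 0 l' - c 1 l'))) ?_ ?_
      · intro c hc
        obtain ⟨hc1, -, hc2⟩ := Finset.mem_filter.1 hc
        rw [Fintype.mem_piFinset] at hc1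
        simp only [Finset.coe_product, Set.mem_prod, Finset.mem_coe]
        exact ⟨hc1 0, Fintype.mem_piFinset.1 (hc1 1) l', Finset.mem_Icc.2 (abs_le.1 hc2)⟩
      · intro c _ c' _ h
        simp only [Prod.mk.injEq] at h
        obtain ⟨h0, h1, h2⟩ := h
        rw [h0, h1] at h2
        have h3 : c 1 l = c' 1 l := by linarith
        funext i
        fin_cases i
        · exact h0
        · funext k
          have : k = l ∨ k = l' := by omega
          rcases this with rfl | rfl
          · exact h3
          · exact h1
    have hcard' : ((T N).card : ℝ) ≤ (s / ε N + 2) ^ 2 * ((s / ε N + 2) * 3) := by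
      have h3 : (Finset.Icc (-1 : ℤ) 1).card = 3 := rfl
      rw [Finset.card_product, Finset.card_product, h3] at hcard
      calc ((T N).card : ℝ) ≤ _ := Nat.cast_le.2 hcard
        _ ≤ _ := by
          push_cast
          have := div_nonneg hs.le (hε N).le
          exact mul_le_mul (card_squareIdx_le hs.le (hε N))
            (mul_le_mul_of_nonneg_right (card_Icc_floor_le hs.le (hε N)) (by norm_num))
            (by positivity) (by positivity)
    refine (mul_le_mul_of_nonneg_right hcard' (by positivity)).trans_eq ?_
    have he := (hε N).ne'
    have e1 : s / ε N + 2 = (s + 2 * ε N) / ε N := by field_simp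
    rw [e1]
    clear_value ε
    field_simp
  · rw [← ENNReal.ofReal_zero]
    apply ENNReal.tendsto_ofReal
    have hc : Continuous fun e : ℝ => 3 * (lam : ℝ) ^ 2 * (s + 2 * e) ^ 3 * e := by fun_prop
    have := (hc.tendsto 0).comp hε0
    rw [mul_zero] at this
    exact this

/-- `γ = 0` handles the two axes, `γ = ±1` the two diagonals; squares of side `K + 1` exhaust the
plane. -/
theorem IsPoissonProcess.ae_generalPosition (hX : IsPoissonProcess P lam X) :
    ∀ᵐ ω ∂P, ∀ ξ ∈ X ω, ∀ η ∈ X ω, ξ ≠ η → GeneralPosition ξ η := by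
  have key : ∀ {l l' : Fin 2}, l ≠ l' → ∀ {γ : ℤ}, |γ| ≤ 1 → ∀ᵐ ω ∂P, ∀ ξ ∈ X ω, ∀ η ∈ X ω,
      ξ ≠ η → (ξ l - η l) + γ * (ξ l' - η l') ≠ 0 := by
    intro l l' hl γ hγ
    filter_upwards [ae_all_iff.2 fun K : ℕ => measure_eq_zero_iff_ae_notMem.1
      (hX.measure_degenerate_pair hl hγ (s := (K : ℝ) + 1) (by positivity))]
      with ω hω ξ hξ η hη hne h0
    obtain ⟨K, hK⟩ := exists_nat_ge (max (2 * supNorm ξ) (2 * supNorm η))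
    have hsq : ∀ ζ : Plane, 2 * supNorm ζ ≤ K → ζ ∈ square ((K : ℝ) + 1) := by
      intro ζ hζ k
      have h2 := abs_le.1 (abs_apply_le_supNorm ζ k)
      constructor <;> linarith
    exact hω K ⟨ξ, hξ, η, hη, hne, hsq ξ ((le_max_left _ _).trans hK),
      hsq η ((le_max_right _ _).trans hK), h0⟩
  filter_upwards [key (l := 0) (l' := 1) (by decide) (γ := 0) (by decide),
    key (l := 1) (l' := 0) (by decide) (γ := 0) (by decide),
    key (l := 0) (l' := 1) (by decide) (γ := 1) (by decide),
    key (l := 0) (l' := 1) (by decide) (γ := -1) (by decide)] with ω h1 h2 h3 h4 ξ hξ η hη hne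
  have h1 := h1 ξ hξ η hη hne
  have h2 := h2 ξ hξ η hη hne
  have h3 := h3 ξ hξ η hη hne
  have h4 := h4 ξ hξ η hη hne
  push_cast at h1 h2 h3 h4
  refine ⟨Fin.forall_fin_two.2 ⟨fun h => h1 (by rw [h]; ring), fun h => h2 (by rw [h]; ring)⟩,
    fun h => ?_⟩
  rcases abs_eq_abs.1 h with h | h
  · exact h4 (by rw [h]; ring)
  · exact h3 (by rw [h]; ring)

end Chain

/-! ### Blocking points -/

/-- The lower corner of the `k`-th square in which points are looked for that stop the points of
the unit cell with index `q` and mark `v`. -/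
noncomputable def blockCorner (q : Fin 2 → ℤ) (v : Mark) (k : ℕ) : Fin 2 → ℝ :=
  fun l => if l = v.1 then q l + sgn v.2 * (10 * (k + 1)) else q l - 1

/-- The `k`-th blocking square. -/
noncomputable def blockBox (q : Fin 2 → ℤ) (v : Mark) (k : ℕ) : Set Plane :=
  box (blockCorner q v k) fun l => blockCorner q v k l + 1

/-- The neighborhood of the `k`-th blocking square that has to be free of other points. -/
noncomputable def blockWindow (q : Fin 2 → ℤ) (v : Mark) (k : ℕ) : Set Plane :=
  box (fun l => blockCorner q v k l - 2) fun l => blockCorner q v k l + 3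

/-- The mark of a blocking point. -/
def blockMark (v : Mark) : Mark := (1 - v.1, true)

theorem blockBox_subset_blockWindow (q : Fin 2 → ℤ) (v : Mark) (k : ℕ) :
    blockBox q v k ⊆ blockWindow q v k := fun ξ hξ l => by
  have := hξ l
  constructor <;> linarith

theorem ne_blockMark (v : Mark) : v.1 ≠ (blockMark v).1 := by
  rcases v with ⟨i, b⟩
  simp only [blockMark]
  omega

/-- The square lies at least nine units ahead, and one row below in the transverse direction. A
point there growing upwards needs less than two units to cross the path. -/
theorem canStop_of_mem_blockBox {q : Fin 2 → ℤ} {v : Mark} {k : ℕ} {ξ η : Plane}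
    (hξ : ξ ∈ gridCell 1 q) (hη : η ∈ blockBox q v k) :
    CanStop (ξ, v) (η, blockMark v) ∧ along (η, blockMark v) (ξ, v) < 2 := by
  rw [gridCell_eq_box one_pos] at hξ
  have hne := ne_blockMark v
  have hi := hξ v.1
  have hj := hξ (blockMark v).1
  have hi' := hη v.1
  have hj' := hη (blockMark v).1
  simp only [blockCorner, if_true, if_neg hne.symm, mul_one] at hi hj hi' hj'
  have e : along (η, blockMark v) (ξ, v) = ξ (blockMark v).1 - η (blockMark v).1 := by
    simp [along, blockMark, sgn]
  have h9 : 9 ≤ along (ξ, v) (η, blockMark v) := by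
    have hk : (0 : ℝ) ≤ k := Nat.cast_nonneg k
    simp only [along]
    rcases v with ⟨i, b⟩
    cases b
    · simp only [sgn, Bool.false_eq_true, if_false] at hi hi' ⊢
      linarith
    · simp only [sgn, if_true] at hi hi' ⊢
      linarith
  refine ⟨⟨hne, ?_, ?_⟩, ?_⟩ <;> simp only [e] <;> linarith

theorem mem_blockWindow {q : Fin 2 → ℤ} {v : Mark} {k : ℕ} {η ζ : Plane}
    (hη : η ∈ blockBox q v k) (h : supNorm (η - ζ) < 2) : ζ ∈ blockWindow q v k := fun l => by
  have h1 := hη l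
  have h2 := abs_lt.1 ((abs_apply_le_supNorm (η - ζ) l).trans_lt h)
  rw [PiLp.sub_apply] at h2
  constructor <;> linarith

/-- The windows have width five and are spaced ten apart along the growth axis. -/
theorem disjoint_blockWindow (q : Fin 2 → ℤ) (v : Mark) {k k' : ℕ} (h : k ≠ k') :
    Disjoint (blockWindow q v k) (blockWindow q v k') := by
  refine Set.disjoint_left.2 fun ξ h1 h2 => ?_
  have h1 := h1 v.1
  have h2 := h2 v.1
  simp only [blockCorner, if_true] at h1 h2
  have hlt : |sgn v.2 * (10 * ((k : ℝ) - k'))| < 5 := by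
    rw [abs_lt]
    constructor <;> linarith
  rw [abs_mul, abs_sgn, one_mul, abs_mul, abs_of_pos (by norm_num : (0 : ℝ) < 10)] at hlt
  have hge : (1 : ℝ) ≤ |(k : ℝ) - k'| := by
    have : (1 : ℤ) ≤ |(k : ℤ) - k'| := Int.one_le_abs (by omega)
    exact_mod_cast this
  linarith

theorem volume_blockBox (q : Fin 2 → ℤ) (v : Mark) (k : ℕ) : volume (blockBox q v k) = 1 := by
  rw [blockBox, volume_box]
  simp

theorem volume_blockWindow_diff (q : Fin 2 → ℤ) (v : Mark) (k : ℕ) :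
    volume (blockWindow q v k \ blockBox q v k) = 24 := by
  rw [measure_sdiff (blockBox_subset_blockWindow q v k) (measurableSet_box _ _).nullMeasurableSet
    (by rw [volume_blockBox]; exact ENNReal.one_ne_top), volume_blockBox, blockWindow, volume_box]
  have : ∀ l, blockCorner q v k l + 3 - (blockCorner q v k l - 2) = 5 := fun l => by ring
  simp only [this, Finset.prod_const, Finset.card_univ, Fintype.card_fin, ENNReal.ofReal_ofNat]
  rw [show (5 : ℝ≥0∞) ^ 2 = 24 + 1 by norm_num]
  exact ENNReal.add_sub_cancel_right ENNReal.one_ne_top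

section Blocking

variable {Ω : Type*} [MeasurableSpace Ω] {P : Measure Ω} {lam : ℝ≥0} {X : Ω → Set Plane}

/-- The event that the `k`-th blocking square contains exactly one point and its neighborhood no
other one. -/
def blockEvent {Ω : Type*} (X : Ω → Set Plane) (q : Fin 2 → ℤ) (v : Mark) (k : ℕ) : Set Ω :=
  {ω | (X ω ∩ blockBox q v k).ncard = 1 ∧
    (X ω ∩ (blockWindow q v k \ blockBox q v k)).ncard = 0}

/-- The two regions on which `blockEvent` depends. -/
noncomputable def blockRegion (q : Fin 2 → ℤ) (v : Mark) (k : ℕ) (c : Bool) : Set Plane :=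
  if c then blockBox q v k else blockWindow q v k \ blockBox q v k

theorem measurableSet_blockRegion (q : Fin 2 → ℤ) (v : Mark) (k : ℕ) (c : Bool) :
    MeasurableSet (blockRegion q v k c) := by
  cases c
  · exact (measurableSet_box _ _).diff (measurableSet_box _ _)
  · exact measurableSet_box _ _

theorem blockRegion_subset (q : Fin 2 → ℤ) (v : Mark) (k : ℕ) (c : Bool) :
    blockRegion q v k c ⊆ blockWindow q v k := by
  cases c
  · exact Set.sdiff_subset
  · exact blockBox_subset_blockWindow q v k

theorem isBounded_blockRegion (q : Fin 2 → ℤ) (v : Mark) (k : ℕ) (c : Bool) :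
    Bornology.IsBounded (blockRegion q v k c) :=
  (isBounded_box _ _).subset (blockRegion_subset q v k c)

theorem disjoint_blockRegion (q : Fin 2 → ℤ) (v : Mark) {k k' : ℕ} {c c' : Bool}
    (h : (k, c) ≠ (k', c')) : Disjoint (blockRegion q v k c) (blockRegion q v k' c') := by
  by_cases hk : k = k'
  · subst hk
    cases c <;> cases c'
    · exact absurd rfl h
    · exact Set.disjoint_sdiff_left
    · exact Set.disjoint_sdiff_right
    · exact absurd rfl h
  · exact (disjoint_blockWindow q v hk).mono (blockRegion_subset q v k c)
      (blockRegion_subset q v k' c')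

theorem blockEvent_eq {Ω : Type*} {X : Ω → Set Plane} (q : Fin 2 → ℤ) (v : Mark) (k : ℕ) :
    blockEvent X q v k =
      {ω | ∀ c : Bool, (X ω ∩ blockRegion q v k c).ncard ∈ (if c then {1} else {0} : Set ℕ)} := by
  ext ω
  simp only [blockEvent, blockRegion, Set.mem_ofPred_eq, Bool.forall_bool, if_true,
    Bool.false_eq_true, if_false, Set.mem_singleton_iff]
  exact and_comm

theorem IsPoissonProcess.measurableSet_blockEvent (hX : IsPoissonProcess P lam X)
    (q : Fin 2 → ℤ) (v : Mark) (k : ℕ) : MeasurableSet (blockEvent X q v k) := by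
  rw [blockEvent_eq, Set.ofPred_forall]
  exact MeasurableSet.iInter fun c => hX.measurable_count _ (measurableSet_blockRegion q v k c)
    (isBounded_blockRegion q v k c) MeasurableSet.of_discrete

theorem IsPoissonProcess.measure_blockEvent (hX : IsPoissonProcess P lam X) (q : Fin 2 → ℤ)
    (v : Mark) (k : ℕ) : P (blockEvent X q v k) =
      ∏ c : Bool, P {ω | (X ω ∩ blockRegion q v k c).ncard ∈ (if c then {1} else {0} : Set ℕ)} := by
  rw [blockEvent_eq, hX.measure_inter_count (fun c => measurableSet_blockRegion q v k c)
    (fun c => isBounded_blockRegion q v k c)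
    (fun c c' h => disjoint_blockRegion q v (by simpa using h))]

theorem IsPoissonProcess.iIndepSet_blockEvent (hX : IsPoissonProcess P lam X) (q : Fin 2 → ℤ)
    (v : Mark) : iIndepSet (blockEvent X q v) P := by
  rw [iIndepSet_iff_meas_biInter fun k => hX.measurableSet_blockEvent q v k]
  intro S
  have h := hX.measure_inter_count (ι := S × Bool)
    (fun p => measurableSet_blockRegion q v p.1 p.2) (fun p => isBounded_blockRegion q v p.1 p.2)
    (fun p p' hp => disjoint_blockRegion q v fun he => hp (by
      rw [Prod.mk.injEq] at he
      exact Prod.ext (Subtype.ext he.1) he.2))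
    (fun p => if p.2 then {1} else {0})
  rw [Fintype.prod_prod_type] at h
  simp_rw [hX.measure_blockEvent]
  rw [← Finset.prod_coe_sort, ← h]
  congr 1
  ext ω
  simp only [Set.mem_iInter, blockEvent_eq, Set.mem_ofPred_eq, Prod.forall, Subtype.forall]

/-- Second Borel–Cantelli lemma: the events are independent and have the same positive probability
for every `k`. -/
theorem IsPoissonProcess.ae_frequently_blockEvent [IsProbabilityMeasure P]
    (hX : IsPoissonProcess P lam X) (hlam : 0 < lam) (q : Fin 2 → ℤ) (v : Mark) :
    ∀ᵐ ω ∂P, ∃ᶠ k in Filter.atTop, ω ∈ blockEvent X q v k := by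
  have hpos : ∀ (r : ℝ≥0) (n : ℕ), 0 < r → poissonMeasure r {n} ≠ 0 := by
    intro r n hr
    rw [poissonMeasure_singleton]
    have : (0 : ℝ) < r := hr
    exact (ENNReal.ofReal_pos.2 (by positivity)).ne'
  have hlim := measure_limsup_eq_one (fun k => hX.measurableSet_blockEvent q v k)
    (hX.iIndepSet_blockEvent q v) (by
      have : ∀ k, P (blockEvent X q v k) = poissonMeasure (lam * (1 : ℝ≥0∞).toNNReal) {1} *
          poissonMeasure (lam * (24 : ℝ≥0∞).toNNReal) {0} := by
        intro k
        rw [hX.measure_blockEvent, Fintype.prod_bool,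
          hX.measure_count (measurableSet_blockRegion q v k _) (isBounded_blockRegion q v k _),
          hX.measure_count (measurableSet_blockRegion q v k _) (isBounded_blockRegion q v k _)]
        simp only [blockRegion, if_true, Bool.false_eq_true, if_false, volume_blockBox,
          volume_blockWindow_diff]
      simp_rw [this]
      refine ENNReal.tsum_const_eq_top_of_ne_zero (mul_ne_zero (hpos _ _ ?_) (hpos _ _ ?_))
      · simpa using hlam
      · exact mul_pos hlam (ENNReal.toNNReal_pos (by norm_num) (by norm_num)))
  have hmeas : MeasurableSet (Filter.limsup (blockEvent X q v) Filter.atTop) :=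
    MeasurableSet.measurableSet_limsup fun k => hX.measurableSet_blockEvent q v k
  filter_upwards [(mem_ae_iff_prob_eq_one hmeas).2 hlim] with ω hω
  rwa [Filter.mem_limsup_iff_frequently_mem] at hω

/-- Independent uniform marks take the value `w` on each infinite random set of indices that is
independent of the marks. -/
theorem ae_exists_mark [IsProbabilityMeasure P] {α : Type*} [MeasurableSpace α] {Z : Ω → α}
    (hZ : Measurable Z) {m : ℕ → Ω → Mark} (hm : ∀ i, Measurable (m i)) {w : Mark}
    (hunif : ∀ i, P {ω | m i ω = w} = 1 / 4) (hind : iIndepFun m P)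
    (hindZ : IndepFun Z (fun ω i => m i ω) P) {A : ℕ → Set α} (hA : ∀ i, MeasurableSet (A i)) :
    ∀ᵐ ω ∂P, (∃ᶠ i in Filter.atTop, Z ω ∈ A i) → ∃ i, Z ω ∈ A i ∧ m i ω = w := by
  have hM : Measurable fun ω i => m i ω := measurable_pi_lambda _ hm
  let bad : Set (α × (ℕ → Mark)) :=
    {p | ∃ᶠ i in Filter.atTop, p.1 ∈ A i} ∩ ⋂ i, ({p | p.1 ∈ A i}ᶜ ∪ {p | p.2 i = w}ᶜ)
  have hAmeas : ∀ i, MeasurableSet {p : α × (ℕ → Mark) | p.1 ∈ A i} := fun i =>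
    measurable_fst (hA i)
  have hbad : MeasurableSet bad := by
    refine MeasurableSet.inter ?_ (MeasurableSet.iInter fun i => (hAmeas i).compl.union ?_)
    · simp_rw [Filter.frequently_atTop, Set.ofPred_forall, Set.ofPred_exists]
      exact MeasurableSet.iInter fun n => MeasurableSet.iUnion fun i =>
        (MeasurableSet.const _).inter (hAmeas i)
    · have hi : Measurable fun p : α × (ℕ → Mark) => p.2 i :=
        (measurable_pi_apply i).comp measurable_snd
      exact (hi (measurableSet_singleton w)).compl
  -- With the index set fixed, `n` of its indices all miss `w` with probability `(3/4)ⁿ`.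
  -- Independence of `Z` and the marks lets these null sections be integrated.
  have hnull : ∀ z, (P.map fun ω i => m i ω) (Prod.mk z ⁻¹' bad) = 0 := by
    intro z
    rw [Measure.map_apply hM (measurable_prodMk_left hbad)]
    by_cases hz : ∃ᶠ i in Filter.atTop, z ∈ A i
    · have hinf : {i | z ∈ A i}.Infinite := Nat.frequently_atTop_iff_infinite.1 hz
      have hle : ∀ n : ℕ, P ((fun ω i => m i ω) ⁻¹' (Prod.mk z ⁻¹' bad)) ≤ (3 / 4 : ℝ≥0∞) ^ n := by
        intro n
        obtain ⟨S, hS, hcard⟩ := hinf.exists_subset_card_eq n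
        have h := (iIndepFun_iff_measure_inter_preimage_eq_mul.1 hind) S (sets := fun _ => {w}ᶜ)
          fun _ _ => (measurableSet_singleton w).compl
        have hone : ∀ i, P (m i ⁻¹' {w}ᶜ) = 3 / 4 := by
          intro i
          rw [Set.preimage_compl, prob_compl_eq_one_sub (hm i (measurableSet_singleton w)),
            show P (m i ⁻¹' {w}) = 1 / 4 from hunif i]
          refine ENNReal.sub_eq_of_eq_add (by simp) ?_
          rw [ENNReal.div_add_div_same, show (3 : ℝ≥0∞) + 1 = 4 by norm_num,
            ENNReal.div_self (by norm_num) (by norm_num)]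
        simp_rw [hone, Finset.prod_const, hcard] at h
        rw [← h]
        refine measure_mono fun ω hω => Set.mem_iInter₂.2 fun i hi => ?_
        rcases Set.mem_iInter.1 hω.2 i with h' | h'
        · exact absurd (hS hi) h'
        · exact h'
      refine le_antisymm (ge_of_tendsto' (ENNReal.tendsto_pow_atTop_nhds_zero_of_lt_one ?_) hle)
        zero_le
      rw [ENNReal.div_lt_iff (by norm_num) (by norm_num)]
      norm_num
    · refine measure_mono_null (fun ω hω => ?_) measure_empty
      exact hz hω.1
  have hzero : P {ω | (Z ω, fun i => m i ω) ∈ bad} = 0 := by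
    have h1 := hindZ.map_prod_eq_prod_map_map hZ.aemeasurable hM.aemeasurable
    have h2 : (P.map fun ω => (Z ω, fun i => m i ω)) bad = 0 := by
      rw [h1]
      have : IsProbabilityMeasure (P.map fun ω i => m i ω) :=
        Measure.isProbabilityMeasure_map hM.aemeasurable
      rw [Measure.measure_prod_null hbad]
      exact Filter.Eventually.of_forall hnull
    rwa [Measure.map_apply (hZ.prodMk hM) hbad] at h2
  filter_upwards [measure_eq_zero_iff_ae_notMem.1 hzero] with ω hω hfreq
  by_contra! h
  refine hω ⟨hfreq, Set.mem_iInter.2 fun i => ?_⟩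
  by_cases hi : Z ω ∈ A i
  · exact Or.inr (h i hi)
  · exact Or.inl hi

/-- The index set of enumerated points which lie in some blocking square and have no other point
in its neighborhood. -/
def blockIndexSet (q : Fin 2 → ℤ) (v : Mark) (i : ℕ) : Set (ℕ∞ × (ℕ → Plane)) :=
  {z | (i : ℕ∞) < z.1 ∧ ∃ k, z.2 i ∈ blockBox q v k ∧
    ∀ j : ℕ, j ≠ i → (j : ℕ∞) < z.1 → z.2 j ∉ blockWindow q v k}

theorem measurableSet_blockIndexSet (q : Fin 2 → ℤ) (v : Mark) (i : ℕ) :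
    MeasurableSet (blockIndexSet q v i) := by
  have h1 : ∀ j : ℕ, MeasurableSet {z : ℕ∞ × (ℕ → Plane) | (j : ℕ∞) < z.1} := fun j =>
    measurable_fst (MeasurableSet.of_discrete (s := Set.Ioi (j : ℕ∞)))
  have h2 : ∀ (j : ℕ) {B : Set Plane}, MeasurableSet B →
      MeasurableSet {z : ℕ∞ × (ℕ → Plane) | z.2 j ∈ B} := fun j B hB =>
    (measurable_pi_apply j).comp measurable_snd hB
  unfold blockIndexSet
  simp_rw [Set.ofPred_and, Set.ofPred_exists, Set.ofPred_and, Set.ofPred_forall]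
  refine (h1 i).inter (MeasurableSet.iUnion fun k => (h2 i (measurableSet_box _ _)).inter
    (MeasurableSet.iInter fun j => MeasurableSet.iInter fun _ => ?_))
  simp_rw [imp_iff_not_or, Set.ofPred_or]
  exact (h1 j).compl.union (h2 j (measurableSet_box _ _)).compl

/-- Isolation in a window is a property of `(κ, ξ)` alone, so it is independent of the marks. It
holds for infinitely many indices, and `ae_exists_mark` finds the desired mark among them. -/
theorem IsUniformlyMarkedPoissonProcess.ae_exists_block [IsProbabilityMeasure P]
    {X : Ω → Set (Plane × Mark)} (hX : IsUniformlyMarkedPoissonProcess P lam X) (hlam : 0 < lam)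
    (q : Fin 2 → ℤ) (v : Mark) :
    ∀ᵐ ω ∂P, ∃ k, ∃ y ∈ X ω, y.2 = blockMark v ∧ y.1 ∈ blockBox q v k ∧
      ∀ z ∈ X ω, z ≠ y → z.1 ∉ blockWindow q v k := by
  obtain ⟨κ, ξ, m, hκ, hξ, hm, henum, hunif, hind, hindZ⟩ := hX.marking
  filter_upwards [henum, hX.poisson.ae_frequently_blockEvent hlam q v,
    ae_exists_mark (hκ.prodMk (measurable_pi_lambda _ hξ)) hm (fun i => hunif i (blockMark v)) hind
      hindZ (measurableSet_blockIndexSet q v)] with ω ⟨hinj, hXω⟩ hfreq hmark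
  have hinfty : {i | (κ ω, fun i => ξ i ω) ∈ blockIndexSet q v i}.Infinite := by
    have hk : ∀ k, ω ∈ blockEvent (fun ω => Prod.fst '' X ω) q v k →
        ∃ i, (κ ω, fun i => ξ i ω) ∈ blockIndexSet q v i ∧ ξ i ω ∈ blockBox q v k := by
      rintro k ⟨h1, h0⟩
      obtain ⟨η, hη⟩ := Set.ncard_eq_one.1 h1
      have h0' := (Set.ncard_eq_zero (hX.poisson.locallyFinite ω _
        ((isBounded_box _ _).subset Set.sdiff_subset))).1 h0
      have hη' : η ∈ Prod.fst '' X ω ∩ blockBox q v k := hη ▸ Set.mem_singleton η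
      obtain ⟨⟨p, hp, rfl⟩, hpB⟩ := hη'
      rw [hXω] at hp
      obtain ⟨i, hi, rfl⟩ := hp
      refine ⟨i, ⟨hi, k, hpB, fun j hj hjκ hjW => ?_⟩, hpB⟩
      have hjX : ξ j ω ∈ Prod.fst '' X ω := ⟨(ξ j ω, m j ω), by rw [hXω]; exact ⟨j, hjκ, rfl⟩, rfl⟩
      by_cases hjB : ξ j ω ∈ blockBox q v k
      · have : ξ j ω ∈ ({ξ i ω} : Set Plane) := hη ▸ ⟨hjX, hjB⟩
        exact hj (hinj hjκ hi this)
      · have : ξ j ω ∈ (∅ : Set Plane) := h0' ▸ ⟨hjX, hjW, hjB⟩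
        exact this
    -- Infinitely many `k` yield infinitely many indices, since one point cannot lie in two of the
    -- disjoint windows.
    choose! g hg1 hg2 using hk
    have hinf := Nat.frequently_atTop_iff_infinite.1 hfreq
    refine Set.infinite_of_injOn_mapsTo (f := g) ?_ (fun k hk => hg1 k hk) hinf
    intro k hk k' hk' he
    by_contra hne
    refine Set.disjoint_left.1 (disjoint_blockWindow q v hne)
      (blockBox_subset_blockWindow q v k (hg2 k hk)) ?_
    rw [he]
    exact blockBox_subset_blockWindow q v k' (hg2 k' hk')
  obtain ⟨i, ⟨hi, k, hB, hW⟩, hmi⟩ := hmark (Nat.frequently_atTop_iff_infinite.2 hinfty)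
  refine ⟨k, (ξ i ω, m i ω), by rw [hXω]; exact ⟨i, hi, rfl⟩, hmi, hB, fun z hz hne => ?_⟩
  rw [hXω] at hz
  obtain ⟨j, hj, rfl⟩ := hz
  exact hW j (fun h => hne (by rw [h])) hj

theorem IsUniformlyMarkedPoissonProcess.ae_isMarkedLocallyFinite
    {X : Ω → Set (Plane × Mark)} (hX : IsUniformlyMarkedPoissonProcess P lam X) :
    ∀ᵐ ω ∂P, IsMarkedLocallyFinite (X ω) := by
  obtain ⟨κ, ξ, m, -, -, -, henum, -⟩ := hX.marking
  filter_upwards [henum] with ω ⟨hinj, hXω⟩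
  have hfst : Set.InjOn Prod.fst (X ω) := by
    rw [hXω]
    rintro _ ⟨i, hi, rfl⟩ _ ⟨j, hj, rfl⟩ h
    rw [hinj hi hj h]
  refine ⟨fun B hB => ?_, hfst⟩
  refine Set.Finite.of_finite_image ((hX.poisson.locallyFinite ω B hB).subset ?_)
    (hfst.mono Set.inter_subset_left)
  rintro _ ⟨p, ⟨hp, hpB, -⟩, rfl⟩
  exact ⟨⟨p, hp, rfl⟩, hpB⟩

theorem IsUniformlyMarkedPoissonProcess.ae_isAdmissible [IsProbabilityMeasure P]
    {X : Ω → Set (Plane × Mark)} (hX : IsUniformlyMarkedPoissonProcess P lam X) (hlam : 0 < lam) :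
    ∀ᵐ ω ∂P, IsAdmissible (X ω) := by
  filter_upwards [hX.ae_isMarkedLocallyFinite, hX.poisson.ae_no_chain,
    hX.poisson.ae_generalPosition,
    ae_all_iff.2 fun q => ae_all_iff.2 fun v => hX.ae_exists_block hlam q v]
    with ω hlf hchain hgp hblock
  have hne : ∀ x ∈ X ω, ∀ y ∈ X ω, x ≠ y → x.1 ≠ y.1 := fun x hx y hy h h' => h (hlf.2 hx hy h')
  have hgen : ∀ x ∈ X ω, ∀ y ∈ X ω, x ≠ y → GeneralPosition x.1 y.1 := fun x hx y hy h =>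
    hgp _ ⟨x, hx, rfl⟩ _ ⟨y, hy, rfl⟩ (hne x hx y hy h)
  obtain ⟨f, hf, huniq, hfin⟩ := exists_unique_length hlf hchain hgen
  refine ⟨?_, hlf, hchain, fun x hx y hy h => (generalPosition_iff (hne x hx y hy h)).1
    (hgen x hx y hy h), f, hf, huniq, fun x => hfin x ?_⟩
  · obtain ⟨k, y, hy, -⟩ := hblock 0 (0, true)
    exact ⟨y, hy⟩
  -- Blocking is available simultaneously for the countably many cells and marks, so it may be
  -- applied at the random cell of `x`.
  · obtain ⟨k, ⟨η, w⟩, hy, rfl, hB, hW⟩ := hblock (idx 1 x.1.1) x.1.2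
    obtain ⟨hcan, hlt⟩ := canStop_of_mem_blockBox (v := x.1.2) (ξ := x.1.1) rfl hB
    refine ⟨_, hy, hcan, fun z hz hzy => hlt.trans_le ?_⟩
    by_contra h
    exact hW z hz hzy (mem_blockWindow hB (not_le.1 h))

end Blocking

end Lilypond

theorem mainTheorem6 {Ω : Type*} [MeasurableSpace Ω] (P : Measure Ω) [IsProbabilityMeasure P]
    (lam : ℝ≥0) (hlam : 0 < lam) :
    (∀ X : Ω → Set Lilypond.Plane, Lilypond.IsPoissonProcess P lam X →
      ∀ (n : ℕ) (b s : ℝ), 1 ≤ n → 0 < b → 0 < s →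
        P (Lilypond.chainEvent X s b n) ≤
          ENNReal.ofReal (s ^ 2 * (4 * b ^ 2) ^ n * (lam : ℝ) ^ (n + 1) / (n.factorial : ℝ))) ∧
    (∀ X : Ω → Set (Lilypond.Plane × Lilypond.Mark),
      Lilypond.IsUniformlyMarkedPoissonProcess P lam X →
        ∀ᵐ ω ∂P, ¬ Lilypond.HasInfiniteDescendingChain (Prod.fst '' X ω) ∧
          Lilypond.IsAdmissible (X ω)) := by
  refine ⟨fun X hX n b s _ hb hs => hX.measure_chainEvent_le n hb hs, fun X hX => ?_⟩
  filter_upwards [hX.poisson.ae_no_chain, hX.ae_isAdmissible hlam] with ω h1 h2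
  exact ⟨h1, h2⟩
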